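/- For a finite sequence of positive integers $\mathbf k=(k_1,\dots,k_r)$ and $n\ge 0$ put $$t_n(\mathbf k)=\sum_{n\ge n_1>n_2>\cdots>n_r>0}\ \prod_{j=1}^r\frac1{(2n_j-1)^{k_j}},\qquad t^\star_n(\mathbf k)=\sum_{n\ge n_1\ge n_2\ge\cdots\ge n_r>0}\ \prod_{j=1}^r\frac1{(2n_j-1)^{k_j}},$$ with $t_n(\emptyset)=t_n^\star(\emptyset)=1$ and $t_n(\mathbf k)=0$ for $n<r$. Let $1_d=(1,\dots,1)$ ($d$ ones), and let $P_n(x)=\frac1{2^n n!}\frac{d^n}{dx^n}(x^2-1)^n$ be the Legendre polynomials. Let $m\ge 0$ be an integer. (i) For every real $x$ with $0<x<1$, $$\frac{\log^m(x)}{\sqrt x}=(-1)^m\,m!\,2^{m+1}\sum_{k=0}^m\ \sum_{n=0}^\infty(-1)^n\,t_n(1_k)\,t^\star_{n+1}(1_{m-k})\,P_n(2x-1),$$ where each of the $m+1$ series over $n$ converges (as the limit of its partial sums). (ii) This is the Fourier--Legendre expansion on $(0,1)$: for every $n\ge 0$ the function $P_n(2x-1)\log^m(x)/\sqrt x$ is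 integrable on $(0,1)$ and $$(2n+1)\int_0^1P_n(2x-1)\frac{\log^m(x)}{\sqrt x}\,dx=(-1)^m\,m!\,2^{m+1}\sum_{k=0}^m(-1)^n\,t_n(1_k)\,t^\star_{n+1}(1_{m-k}).$$ (iii) For every $n\ge 0$ and every real $x>0$, the $n$-th derivative exists and is $$\frac{d^n}{dx^n}\left(\frac{\log^m(x)}{\sqrt x}\right)=(-1)^n\frac{(2n)!}{n!\,4^n}\sum_{k=0}^m(-1)^k\,k!\binom mk 2^k\,t_n(1_k)\,\frac{\log^{m-k}(x)}{x^{n+1/2}}.$$ -/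

import Mathlib

open Filter Topology

/-- The Legendre polynomial `P_n`, by the Rodrigues formula
`P_n = 1 / (2 ^ n n!) * (d / dX) ^ n (X ^ 2 - 1) ^ n`. -/
noncomputable def legendreP (n : ℕ) : Polynomial ℝ :=
  Polynomial.C (1 / ((2 : ℝ) ^ n * (n.factorial : ℝ))) *
    (Polynomial.derivative^[n] ((Polynomial.X ^ 2 - 1) ^ n))

/-- The multiple `t`-harmonic sum of a composition `(k_1, ..., k_r)`,
`t_n(k_1, ..., k_r) = ∑_{n ≥ n_1 > n_2 > ... > n_r > 0} ∏_j 1 / (2 n_j - 1) ^ k_j`,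
written as an iterated sum: the outermost index `j` is `n_1`, and the remaining indices
run below it. It is `1` on the empty composition and `0` when `n < r`. -/
noncomputable def tSum : ℕ → List ℕ → ℝ
  | _, [] => 1
  | n, k :: ks => ∑ j ∈ Finset.Icc 1 n, 1 / (2 * (j : ℝ) - 1) ^ k * tSum (j - 1) ks

/-- The multiple `t`-harmonic star sum of a composition `(k_1, ..., k_r)`,
`t*_n(k_1, ..., k_r) = ∑_{n ≥ n_1 ≥ n_2 ≥ ... ≥ n_r > 0} ∏_j 1 / (2 n_j - 1) ^ k_j`,
written as an iterated sum. -/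
noncomputable def tStarSum : ℕ → List ℕ → ℝ
  | _, [] => 1
  | n, k :: ks => ∑ j ∈ Finset.Icc 1 n, 1 / (2 * (j : ℝ) - 1) ^ k * tStarSum j ks

/-- The composition `1_d = (1, ..., 1)` with `d` ones. -/
def onesComp (d : ℕ) : List ℕ := List.replicate d 1

/-!
The function `f = log ^ m x / √x` is an eigenfunction, up to lower powers of the logarithm, of the
Euler operator `x d/dx`, while `(1 + y) (P_{n+1}' - P_n') = (n + 1) (P_{n+1} + P_n)`. Integrating the
derivative of `x f (P_{n+1} - P_n)(2 x - 1)` over `(0, 1)` therefore gives a recursion in `m` and `n`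
for the moments of `f` (`logMoment_rec`). The sums `∑ₖ t_n(1_k) t*_{n+1}(1_{m-k})` obey the same
recursion (`tCoeffTotal_succ_sub`), because their generating series in `m` is the product
`∏_{j ≤ n} (1 + X / (2 j - 1)) / ∏_{j ≤ n + 1} (1 - X / (2 j - 1))`; this yields the
Fourier-Legendre coefficients (`logMoment_eq`).

For the pointwise expansion, `f` itself is not bounded (nor square integrable), but `x f` is
continuous on `[0, 1]`. Its Legendre coefficients are, up to constants, second-order differences of
the moments of `f`, and the recursion shows that they are absolutely summable
(`summable_abs_tMomentDiff`). As `|P_n| ≤ 1` on `[-1, 1]` and the Legendre polynomials are complete,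
`x f` is the sum of its Legendre series (`hasSum_legendre_of_summable`). The partial sums of `2 x`
times the series of `f` differ from those of the series of `2 x f` by a boundary term
(`sum_tCoeffTotal_mul_legendreP`), which tends to `0` because the coefficients grow like powers of
`log n` and `P_n(y) = O(n ^ (-1/4))` for `|y| < 1` (`abs_eval_legendreP_le_rpow`). That bound on `P_n`
comes from a Turán-type quadratic form in `P_n, P_{n+1}` that is almost conserved by Bonnet's
recurrence. Each of the `m + 1` series converges separately by a summation by parts using the same
bound (`exists_tendsto_sum_mul_legendreP`).

The formula for the higher derivatives is an induction on `n`, in which the recursion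
`t_{n+1}(1_{k+1}) = t_n(1_{k+1}) + t_n(1_k) / (2 n + 1)` appears.
-/

/-! ### Legendre polynomials: recurrences -/

open Polynomial in
theorem derivative_iterate_X_mul (n : ℕ) (p : ℝ[X]) :
    derivative^[n + 1] (X * p) = X * derivative^[n + 1] p + ((n : ℝ[X]) + 1) * derivative^[n] p := by
  have := iterate_derivative_mul_X (n := n + 1) p
  rw [mul_comm X p, this]
  simp [nsmul_eq_mul]
  ring

open Polynomial in
theorem derivative_X_sq_sub_one_pow_succ (n : ℕ) :
    derivative ((X ^ 2 - 1 : ℝ[X]) ^ (n + 1)) =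
      C (2 * ((n : ℝ) + 1)) * (X * (X ^ 2 - 1) ^ n) := by
  rw [derivative_pow]
  simp only [derivative_sub, derivative_X_pow, derivative_one, C_mul, C_add, map_natCast, C_1,
    Nat.add_sub_cancel, Nat.cast_add, Nat.cast_one, Nat.cast_ofNat, map_ofNat, sub_zero]
  ring

/-- The ratio of the normalizing constants in Rodrigues' formula. -/
theorem legendreP_const_succ (n : ℕ) :
    (1 : ℝ) / (2 ^ (n + 1) * ((n + 1).factorial : ℝ)) * (2 * ((n : ℝ) + 1)) =
      1 / (2 ^ n * (n.factorial : ℝ)) := by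
  rw [Nat.factorial_succ]
  push_cast
  field_simp
  ring

open Polynomial in
theorem derivative_legendreP_succ (n : ℕ) :
    derivative (legendreP (n + 1)) =
      X * derivative (legendreP n) + C ((n : ℝ) + 1) * legendreP n := by
  unfold legendreP
  rw [← legendreP_const_succ n]
  simp only [derivative_C_mul, ← Function.iterate_succ_apply']
  rw [Function.iterate_succ_apply, derivative_X_sq_sub_one_pow_succ, iterate_derivative_C_mul,
    derivative_iterate_X_mul]
  simp only [C_mul, C_add, map_natCast, C_1]
  ring

open Polynomial in
/-- The lowering relation. Writing `W = X ^ 2 - 1`, it comes from computing `D ^ (n + 1) W ^ (n + 1)`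
in two ways: from `W ^ (n + 1) = W * W ^ n`, and from `D W ^ (n + 1) = 2 (n + 1) X W ^ n`. -/
theorem X_sq_sub_one_mul_derivative_legendreP (n : ℕ) :
    (X ^ 2 - 1) * derivative (legendreP n) =
      C ((n : ℝ) + 1) * (legendreP (n + 1) - X * legendreP n) := by
  have h1 : derivative^[n + 1] ((X ^ 2 - 1 : ℝ[X]) ^ (n + 1)) =
      C (2 * ((n : ℝ) + 1)) * derivative^[n] (X * (X ^ 2 - 1) ^ n) := by
    rw [Function.iterate_succ_apply, derivative_X_sq_sub_one_pow_succ, iterate_derivative_C_mul]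
  have h2 : derivative^[n + 1] ((X ^ 2 - 1 : ℝ[X]) ^ (n + 1)) =
      (X ^ 2 - 1) * derivative^[n + 1] ((X ^ 2 - 1) ^ n) +
        ((n : ℝ[X]) + 1) * X * derivative^[n] ((X ^ 2 - 1) ^ n) +
        ((n : ℝ[X]) + 1) * derivative^[n] (X * (X ^ 2 - 1) ^ n) := by
    rw [show (X ^ 2 - 1 : ℝ[X]) ^ (n + 1) = X * (X * (X ^ 2 - 1) ^ n) - (X ^ 2 - 1) ^ n by ring,
      iterate_derivative_sub, derivative_iterate_X_mul, derivative_iterate_X_mul]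
    ring
  unfold legendreP
  rw [← legendreP_const_succ n]
  simp only [derivative_C_mul, ← Function.iterate_succ_apply']
  have h3 : (X ^ 2 - 1 : ℝ[X]) * derivative^[n + 1] ((X ^ 2 - 1) ^ n) +
        ((n : ℝ[X]) + 1) * X * derivative^[n] ((X ^ 2 - 1) ^ n) =
        ((n : ℝ[X]) + 1) * derivative^[n] (X * (X ^ 2 - 1) ^ n) := by
    rw [h1] at h2
    simp only [C_mul, C_add, map_natCast, C_1, map_ofNat] at h2
    linear_combination -h2
  rw [h1]
  simp only [C_mul, C_add, map_natCast, C_1, map_ofNat]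
  linear_combination (C (1 / (2 ^ (n + 1) * ((n + 1).factorial : ℝ))) * 2 * ((n : ℝ[X]) + 1)) * h3

theorem legendreP_zero : legendreP 0 = 1 := by simp [legendreP]

theorem legendreP_one : legendreP 1 = Polynomial.X := by
  have h := X_sq_sub_one_mul_derivative_legendreP 0
  rw [legendreP_zero] at h
  have h' : 0 = legendreP 1 - Polynomial.X := by simpa using h
  exact (sub_eq_zero.mp h'.symm)

open Polynomial in
theorem X_sq_sub_one_mul_derivative_legendreP_succ (n : ℕ) :
    (X ^ 2 - 1) * derivative (legendreP (n + 1)) =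
      C ((n : ℝ) + 1) * (X * legendreP (n + 1) - legendreP n) := by
  rw [derivative_legendreP_succ]
  linear_combination X * X_sq_sub_one_mul_derivative_legendreP n

open Polynomial in
theorem legendreP_recurrence (n : ℕ) :
    C ((n : ℝ) + 2) * legendreP (n + 2) =
      C (2 * (n : ℝ) + 3) * X * legendreP (n + 1) - C ((n : ℝ) + 1) * legendreP n := by
  have h1 := X_sq_sub_one_mul_derivative_legendreP_succ n
  have h2 := X_sq_sub_one_mul_derivative_legendreP (n + 1)
  rw [h1] at h2
  push_cast at h2
  simp only [C_mul, C_add, map_natCast, C_1, map_ofNat, add_assoc] at h2 ⊢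
  linear_combination -h2

/-- Bonnet's recurrence, in a form valid for `n = 0` as well. -/
theorem eval_legendreP_recurrence (n : ℕ) (y : ℝ) :
    ((n : ℝ) + 1) * (legendreP (n + 1)).eval y =
      (2 * (n : ℝ) + 1) * y * (legendreP n).eval y - n * (legendreP (n - 1)).eval y := by
  rcases n with _ | n
  · simp [legendreP_zero, legendreP_one]
  · have := congrArg (Polynomial.eval y) (legendreP_recurrence n)
    simp at this
    push_cast
    linear_combination this

open Polynomial in
theorem X_add_one_mul_derivative_legendreP_sub (n : ℕ) :
    (X + 1) * derivative (legendreP (n + 1) - legendreP n) =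
      C ((n : ℝ) + 1) * (legendreP (n + 1) + legendreP n) := by
  have h1 := X_sq_sub_one_mul_derivative_legendreP_succ n
  have h2 := X_sq_sub_one_mul_derivative_legendreP n
  have h : (X - C (1 : ℝ)) ≠ 0 := X_sub_C_ne_zero 1
  apply mul_left_cancel₀ h
  rw [derivative_sub, C_1]
  linear_combination h1 - h2

theorem eval_one_legendreP (n : ℕ) : (legendreP n).eval 1 = 1 := by
  induction n with
  | zero => simp [legendreP_zero]
  | succ n ih =>
    have := congrArg (Polynomial.eval 1) (X_sq_sub_one_mul_derivative_legendreP n)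
    simp [ih] at this
    rcases this with h | h
    · exact absurd h (by positivity)
    · linarith

theorem eval_neg_legendreP (n : ℕ) (y : ℝ) :
    (legendreP n).eval (-y) = (-1) ^ n * (legendreP n).eval y := by
  induction n using Nat.strong_induction_on with
  | _ n ih =>
    rcases n with _ | n
    · simp [legendreP_zero]
    · have h1 := eval_legendreP_recurrence n y
      have h2 := eval_legendreP_recurrence n (-y)
      have h0 : ((n : ℝ) + 1) ≠ 0 := by positivity
      apply mul_left_cancel₀ h0
      rw [h2, ih n (by omega), ih (n - 1) (by omega)]
      rcases n with _ | n
      · simp [legendreP_zero, legendreP_one]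
      · rw [Nat.add_sub_cancel] at *
        linear_combination -(-1) ^ n * h1

/-! ### Legendre polynomials: bounds -/

/-- The Casorati-type energy `P_n² - 2 y P_n P_{n+1} + P_{n+1}²` does not increase with `n`,
and it equals `1 - y²` for `n = 0`. -/
theorem legendreP_energy_le (n : ℕ) {y : ℝ} (hy : |y| ≤ 1) :
    (legendreP n).eval y ^ 2 - 2 * y * (legendreP n).eval y * (legendreP (n + 1)).eval y +
      (legendreP (n + 1)).eval y ^ 2 ≤ 1 - y ^ 2 := by
  have hy2 : 0 ≤ 1 - y ^ 2 := by nlinarith [abs_le.mp hy]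
  induction n with
  | zero => simp [legendreP_zero, legendreP_one]; nlinarith
  | succ n ih =>
    have h := eval_legendreP_recurrence (n + 1) y
    rw [Nat.add_sub_cancel] at h
    push_cast at h
    set p := (legendreP n).eval y
    set q := (legendreP (n + 1)).eval y
    set r := (legendreP (n + 1 + 1)).eval y
    -- With `ρ = (n + 1) / (n + 2)`, the recurrence reads `r - y q = ρ (y q - p)`.
    have hr : r - y * q = ((n : ℝ) + 1) / (n + 2) * (y * q - p) := by
      field_simp
      linear_combination h
    have hρ : ((n : ℝ) + 1) / (n + 2) ≤ 1 := by rw [div_le_one (by positivity)]; linarith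
    have hρ0 : 0 ≤ ((n : ℝ) + 1) / (n + 2) := by positivity
    have h2 : (r - y * q) ^ 2 ≤ (y * q - p) ^ 2 := by
      rw [hr, mul_pow]
      exact mul_le_of_le_one_left (sq_nonneg _) (pow_le_one₀ hρ0 hρ)
    nlinarith

theorem abs_eval_legendreP_le_one (n : ℕ) {y : ℝ} (hy : |y| ≤ 1) :
    |(legendreP n).eval y| ≤ 1 := by
  have hlt : ∀ y : ℝ, |y| < 1 → |(legendreP n).eval y| ≤ 1 := by
    intro y hy
    have h := legendreP_energy_le n hy.le
    have hy2 : 0 < 1 - y ^ 2 := by nlinarith [abs_lt.mp hy]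
    rw [← sq_le_one_iff_abs_le_one]
    by_contra! hc
    nlinarith [sq_nonneg ((legendreP (n + 1)).eval y - y * (legendreP n).eval y)]
  rcases hy.lt_or_eq with h | h
  · exact hlt y h
  · rcases eq_or_eq_neg_of_abs_eq h with rfl | rfl
    · simp [eval_one_legendreP]
    · simp [eval_neg_legendreP, eval_one_legendreP]

/-- The Turán-type form attached to the normalized polynomials `√(n + 1/2) P_n` grows
at most like `√n`: its increments are at most `1 / (2 (2 n + 3))`. -/
theorem legendreP_turan_le (n : ℕ) {y : ℝ} (hy : |y| ≤ 1) :
    ((n : ℝ) + 1 / 2) * (legendreP n).eval y ^ 2 -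
      2 * y * (n + 1) * (legendreP n).eval y * (legendreP (n + 1)).eval y +
      (n + 1) ^ 2 / (n + 1 / 2) * (legendreP (n + 1)).eval y ^ 2 ≤ √((n : ℝ) + 1) := by
  induction n with
  | zero => simp [legendreP_zero, legendreP_one]; nlinarith
  | succ n ih =>
    have h := eval_legendreP_recurrence (n + 1) y
    rw [Nat.add_sub_cancel] at h
    have hp := abs_eval_legendreP_le_one n hy
    rw [← sq_le_one_iff_abs_le_one] at hp
    push_cast at h ⊢
    set p := (legendreP n).eval y
    set q := (legendreP (n + 1)).eval y
    set r := (legendreP (n + 1 + 1)).eval y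
    have hr : r = ((2 * ((n : ℝ) + 1) + 1) * y * q - (n + 1) * p) / (n + 1 + 1) := by
      field_simp
      linear_combination h
    have hs : √((n : ℝ) + 1) + 1 / (2 * (2 * n + 3)) ≤ √((n : ℝ) + 1 + 1) := by
      apply Real.le_sqrt_of_sq_le
      have h1 := Real.sq_sqrt (show (0 : ℝ) ≤ n + 1 by positivity)
      have h2 : √((n : ℝ) + 1) ≤ n + 1 := by
        rw [Real.sqrt_le_left (by positivity)]
        nlinarith [(Nat.cast_nonneg n : (0 : ℝ) ≤ n)]
      have h3 : 1 / (2 * (2 * (n : ℝ) + 3)) * (n + 1) ≤ 1 / 4 := by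
        rw [div_mul_eq_mul_div, div_le_div_iff₀ (by positivity) (by positivity)]; linarith
      have h4 : 1 / (2 * (2 * (n : ℝ) + 3)) ≤ 1 / 4 := by
        rw [div_le_div_iff₀ (by positivity) (by positivity)]
        linarith [(Nat.cast_nonneg n : (0 : ℝ) ≤ n)]
      have h5 : 0 ≤ 1 / (2 * (2 * (n : ℝ) + 3)) := by positivity
      nlinarith
    refine le_trans ?_ hs
    -- The form is conserved up to a term of relative order `1 / n ^ 2`.
    have key : ((n : ℝ) + 1 + 1 / 2) * q ^ 2 - 2 * y * (n + 1 + 1) * q * r +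
        (n + 1 + 1) ^ 2 / (n + 1 + 1 / 2) * r ^ 2 =
        ((n : ℝ) + 1 / 2) * p ^ 2 - 2 * y * (n + 1) * p * q + (n + 1) ^ 2 / (n + 1 / 2) * q ^ 2 -
        (q ^ 2 * (n + 3 / 2) - p ^ 2 * (n + 1 / 2)) / ((2 * n + 1) * (2 * n + 3)) := by
      rw [hr]; field_simp; ring
    rw [key]
    have : -((q ^ 2 * ((n : ℝ) + 3 / 2) - p ^ 2 * (n + 1 / 2)) / ((2 * n + 1) * (2 * n + 3))) ≤
        1 / (2 * (2 * n + 3)) := by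
      rw [← neg_div, div_le_div_iff₀ (by positivity) (by positivity)]
      have : 0 ≤ q ^ 2 * ((n : ℝ) + 3 / 2) := by positivity
      have h6 : (0 : ℝ) ≤ 2 * n + 3 := by positivity
      have h7 : (0 : ℝ) ≤ 2 * n + 1 := by positivity
      have h8 : -(q ^ 2 * ((n : ℝ) + 3 / 2) - p ^ 2 * (n + 1 / 2)) ≤ (2 * n + 1) / 2 := by nlinarith
      nlinarith [mul_le_mul_of_nonneg_right h8 h6]
    linarith

/-- Decay of `P_n(y)` in the interior: the Turán-type form dominates `(1 - y²) (n + 1/2) P_n²`. The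
true order is `n ^ (-1/2)`, but any negative power would do here. -/
theorem abs_eval_legendreP_le_rpow {y : ℝ} (hy : |y| < 1) :
    ∃ C : ℝ, 0 ≤ C ∧ ∀ n : ℕ, |(legendreP n).eval y| ≤ C * ((n : ℝ) + 1) ^ (-(1 / 4) : ℝ) := by
  have hy2 : 0 < 1 - y ^ 2 := by nlinarith [abs_lt.mp hy]
  refine ⟨√(2 / (1 - y ^ 2)), by positivity, fun n => ?_⟩
  have hn : (0 : ℝ) < n + 1 := by positivity
  have h := legendreP_turan_le n hy.le
  set p := (legendreP n).eval y
  set q := (legendreP (n + 1)).eval y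
  have h1 : (1 - y ^ 2) * ((n : ℝ) + 1 / 2) * p ^ 2 ≤ √((n : ℝ) + 1) := by
    refine le_trans ?_ h
    have : 0 ≤ ((n : ℝ) + 1 / 2) * (y * p - (n + 1) / (n + 1 / 2) * q) ^ 2 := by positivity
    have e : ((n : ℝ) + 1 / 2) * (y * p - (n + 1) / (n + 1 / 2) * q) ^ 2 =
      (n + 1 / 2) * p ^ 2 - 2 * y * (n + 1) * p * q + (n + 1) ^ 2 / (n + 1 / 2) * q ^ 2 -
        (1 - y ^ 2) * ((n : ℝ) + 1 / 2) * p ^ 2 := by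
      field_simp; ring
    linarith
  have h2 : p ^ 2 ≤ 2 / (1 - y ^ 2) * ((n : ℝ) + 1) ^ (-(1 / 2) : ℝ) := by
    have e : ((n : ℝ) + 1) ^ (-(1 / 2) : ℝ) = √((n : ℝ) + 1) / (n + 1) := by
      rw [Real.sqrt_eq_rpow, ← Real.rpow_sub_one hn.ne']; norm_num
    rw [e, div_mul_div_comm, le_div_iff₀ (by positivity)]
    have : 0 ≤ (1 - y ^ 2) * (n * p ^ 2) := by positivity
    nlinarith
  have e : (((n : ℝ) + 1) ^ (-(1 / 4) : ℝ)) ^ 2 = ((n : ℝ) + 1) ^ (-(1 / 2) : ℝ) := by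
    rw [← Real.rpow_natCast, ← Real.rpow_mul hn.le]; norm_num
  refine abs_le_of_sq_le_sq ?_ (by positivity)
  rw [mul_pow, Real.sq_sqrt (by positivity), e]
  exact h2

/-! ### Legendre polynomials: orthogonality and completeness on `(0, 1)` -/

theorem eval_legendreP_shift_recurrence (n : ℕ) (x : ℝ) :
    (2 * (n : ℝ) + 1) * (2 * x) * (legendreP n).eval (2 * x - 1) =
      (2 * (n : ℝ) + 1) * (legendreP n).eval (2 * x - 1) +
        (n + 1) * (legendreP (n + 1)).eval (2 * x - 1) +
        n * (legendreP (n - 1)).eval (2 * x - 1) := by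
  have := eval_legendreP_recurrence n (2 * x - 1)
  linear_combination -this

theorem continuous_eval_legendreP_shift (n : ℕ) :
    Continuous fun x : ℝ => (legendreP n).eval (2 * x - 1) :=
  (legendreP n).continuous.comp (by fun_prop)

theorem hasDerivAt_eval_legendreP_shift (n : ℕ) (x : ℝ) :
    HasDerivAt (fun x : ℝ => (legendreP n).eval (2 * x - 1))
      (2 * (legendreP n).derivative.eval (2 * x - 1)) x := by
  have h1 : HasDerivAt (fun x : ℝ => 2 * x - 1) 2 x := by
    simpa using ((hasDerivAt_id x).const_mul 2).sub_const 1
  have := ((legendreP n).hasDerivAt (2 * x - 1)).comp x h1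
  rw [mul_comm] at this
  exact this

/-- The Legendre moments of an interval integrable weight satisfy the three-term relation
inherited from multiplication by `x`. -/
theorem integral_mul_legendreP_recurrence {g : ℝ → ℝ}
    (hg : IntervalIntegrable g MeasureTheory.volume 0 1) (n : ℕ) :
    (2 * (n : ℝ) + 1) * (2 * ∫ x in (0 : ℝ)..1, (x * g x) * (legendreP n).eval (2 * x - 1)) =
      (2 * (n : ℝ) + 1) * (∫ x in (0 : ℝ)..1, g x * (legendreP n).eval (2 * x - 1)) +
        (n + 1) * (∫ x in (0 : ℝ)..1, g x * (legendreP (n + 1)).eval (2 * x - 1)) +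
        n * (∫ x in (0 : ℝ)..1, g x * (legendreP (n - 1)).eval (2 * x - 1)) := by
  have hi : ∀ j, IntervalIntegrable (fun x => g x * (legendreP j).eval (2 * x - 1))
      MeasureTheory.volume 0 1 := fun j =>
    hg.mul_continuousOn (continuous_eval_legendreP_shift j).continuousOn
  simp only [← intervalIntegral.integral_const_mul]
  rw [← intervalIntegral.integral_add ((hi _).const_mul _) ((hi _).const_mul _),
    ← intervalIntegral.integral_add (((hi _).const_mul _).add ((hi _).const_mul _))
      ((hi _).const_mul _)]
  refine intervalIntegral.integral_congr fun x _ => ?_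
  linear_combination g x * eval_legendreP_shift_recurrence n x

theorem integral_legendreP_mul_one (n : ℕ) :
    ∫ x in (0 : ℝ)..1, (legendreP n).eval (2 * x - 1) = if n = 0 then 1 else 0 := by
  rcases n with _ | n
  · simp [legendreP_zero]
  · -- `P_{n+2} - X P_{n+1}` vanishes at `1` and `-1`, and its derivative is `(n + 1) P_{n+1}`.
    have hF : ∀ x : ℝ, HasDerivAt (fun x : ℝ => (legendreP (n + 2)).eval (2 * x - 1) -
        (2 * x - 1) * (legendreP (n + 1)).eval (2 * x - 1))
        (2 * ((n : ℝ) + 1) * (legendreP (n + 1)).eval (2 * x - 1)) x := by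
      intro x
      have h1 : HasDerivAt (fun x : ℝ => 2 * x - 1) 2 x := by
        simpa using ((hasDerivAt_id x).const_mul 2).sub_const 1
      have h2 := (hasDerivAt_eval_legendreP_shift (n + 2) x).sub
        (h1.mul (hasDerivAt_eval_legendreP_shift (n + 1) x))
      have h3 := congrArg (Polynomial.eval (2 * x - 1)) (derivative_legendreP_succ (n + 1))
      simp at h3
      convert! h2 using 1
      rw [h3]
      ring
    have h := intervalIntegral.integral_eq_sub_of_hasDerivAt (a := (0 : ℝ)) (b := 1)
      (fun x _ => hF x)
      (((continuous_eval_legendreP_shift (n + 1)).const_mul _).intervalIntegrable 0 1)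
    rw [intervalIntegral.integral_const_mul] at h
    norm_num [eval_one_legendreP, eval_neg_legendreP] at h
    have h4 : -(-1 : ℝ) ^ (n + 1) + -(-1) ^ (n + 2) = 0 := by ring
    rw [h4] at h
    simpa [(by positivity : (n : ℝ) + 1 ≠ 0)] using h

/-- Orthogonality, by induction on the second index. -/
theorem integral_legendreP_mul_legendreP (n m : ℕ) :
    ∫ x in (0 : ℝ)..1, (legendreP n).eval (2 * x - 1) * (legendreP m).eval (2 * x - 1) =
      if n = m then 1 / (2 * (n : ℝ) + 1) else 0 := by
  -- Multiplication by `x` is symmetric, so it can be expanded on either index.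
  have hr : ∀ n m : ℕ,
      (2 * (n : ℝ) + 1) * (((m : ℝ) + 1) *
        ∫ x in (0 : ℝ)..1, (legendreP n).eval (2 * x - 1) * (legendreP (m + 1)).eval (2 * x - 1)) =
      (2 * (m : ℝ) + 1) * ((n + 1) *
        (∫ x in (0 : ℝ)..1, (legendreP (n + 1)).eval (2 * x - 1) * (legendreP m).eval (2 * x - 1))
        + n *
        ∫ x in (0 : ℝ)..1, (legendreP (n - 1)).eval (2 * x - 1) * (legendreP m).eval (2 * x - 1))
      - (2 * (n : ℝ) + 1) * (m *
        ∫ x in (0 : ℝ)..1, (legendreP n).eval (2 * x - 1) * (legendreP (m - 1)).eval (2 * x - 1))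
      := by
    intro n m
    have h1 := integral_mul_legendreP_recurrence
      ((continuous_eval_legendreP_shift n).intervalIntegrable 0 1) m
    have h2 := integral_mul_legendreP_recurrence
      ((continuous_eval_legendreP_shift m).intervalIntegrable 0 1) n
    have e : ∫ x in (0 : ℝ)..1,
        x * (legendreP n).eval (2 * x - 1) * (legendreP m).eval (2 * x - 1) =
        ∫ x in (0 : ℝ)..1,
        x * (legendreP m).eval (2 * x - 1) * (legendreP n).eval (2 * x - 1) :=
      intervalIntegral.integral_congr fun x _ => by ring
    have hs : ∀ i j, ∫ x in (0 : ℝ)..1,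
        (legendreP i).eval (2 * x - 1) * (legendreP j).eval (2 * x - 1) =
        ∫ x in (0 : ℝ)..1, (legendreP j).eval (2 * x - 1) * (legendreP i).eval (2 * x - 1) :=
      fun i j => intervalIntegral.integral_congr fun x _ => mul_comm _ _
    rw [e] at h1
    rw [hs (n + 1), hs (n - 1)]
    rw [hs m n] at h2
    linear_combination (2 * (m : ℝ) + 1) * h2 - (2 * (n : ℝ) + 1) * h1
  induction m using Nat.strong_induction_on generalizing n with
  | _ m ih =>
    rcases m with _ | m
    · simp only [legendreP_zero, Polynomial.eval_one, mul_one, integral_legendreP_mul_one]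
      split_ifs with h <;> simp [h]
    · have h := hr n m
      rw [ih m (by omega), ih m (by omega)] at h
      have h0 : (2 * (n : ℝ) + 1) * ((m : ℝ) + 1) ≠ 0 := by positivity
      apply mul_left_cancel₀ h0
      rw [mul_assoc, h]
      rw [ih (m - 1) (by omega)]
      by_cases h1 : n = m + 1
      · subst h1
        rw [if_neg (by omega), if_pos (by omega), if_neg (by omega), if_pos rfl]
        push_cast [Nat.add_sub_cancel]
        field_simp
        ring
      by_cases h2 : m = n + 1
      · subst h2
        rw [if_pos rfl, if_neg (by omega), if_pos (by omega), if_neg (by omega)]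
        push_cast
        field_simp
        ring
      · rw [if_neg (by omega), if_neg h1]
        have h3 : (n : ℝ) * (if n - 1 = m then 1 / (2 * ((n - 1 : ℕ) : ℝ) + 1) else 0) = 0 := by
          rcases n with _ | n
          · simp
          · rw [if_neg (by omega), mul_zero]
        have h4 : (m : ℝ) * (if n = m - 1 then 1 / (2 * (n : ℝ) + 1) else 0) = 0 := by
          rcases m with _ | m
          · simp
          · rw [if_neg (by omega), mul_zero]
        rw [h3, h4]
        ring

/-- A continuous function on `[0, 1]` orthogonal to all shifted Legendre polynomials vanishes. -/
theorem eq_zero_of_integral_mul_legendreP_eq_zero {g : ℝ → ℝ}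
    (hg : ContinuousOn g (Set.Icc 0 1))
    (h : ∀ n, ∫ x in (0 : ℝ)..1, g x * (legendreP n).eval (2 * x - 1) = 0) :
    ∀ x ∈ Set.Icc (0 : ℝ) 1, g x = 0 := by
  -- The functions orthogonal to all `P_n(2 x - 1)` are stable under multiplication by `x`.
  have hu : Set.uIcc (0 : ℝ) 1 = Set.Icc 0 1 := Set.uIcc_of_le zero_le_one
  have hpow : ∀ k n : ℕ,
      ∫ x in (0 : ℝ)..1, (x ^ k * g x) * (legendreP n).eval (2 * x - 1) = 0 := by
    intro k
    induction k with
    | zero => simpa using h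
    | succ k ih =>
      intro n
      have hc : ContinuousOn (fun x => x ^ k * g x) (Set.uIcc 0 1) := by
        rw [hu]; exact (continuous_pow k).continuousOn.mul hg
      have := integral_mul_legendreP_recurrence hc.intervalIntegrable n
      rw [ih, ih, ih] at this
      have h0 : (2 * (n : ℝ) + 1) ≠ 0 := by positivity
      simp [h0] at this
      refine Eq.trans (intervalIntegral.integral_congr fun x _ => ?_) this
      ring
  have hpoly : ∀ p : Polynomial ℝ, ∫ x in (0 : ℝ)..1, g x * p.eval x = 0 := by
    intro p
    simp only [Polynomial.eval_eq_sum_range, Finset.mul_sum]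
    rw [intervalIntegral.integral_finsetSum]
    · refine Finset.sum_eq_zero fun k _ => ?_
      have := hpow k 0
      simp only [legendreP_zero, Polynomial.eval_one, mul_one] at this
      rw [show (fun x : ℝ => g x * (p.coeff k * x ^ k)) = fun x => p.coeff k * (x ^ k * g x) by
        ext x; ring, intervalIntegral.integral_const_mul, this, mul_zero]
    · intro k _
      apply ContinuousOn.intervalIntegrable
      rw [hu]
      exact hg.mul (by fun_prop)
  -- Approximating `g` uniformly by polynomials, `g` is orthogonal to itself.
  have hsq : ∫ x in (0 : ℝ)..1, g x ^ 2 = 0 := by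
    obtain ⟨M, hM⟩ := isCompact_Icc.exists_bound_of_continuousOn hg
    have hM0 : 0 ≤ M := (norm_nonneg _).trans (hM 0 (by simp))
    have hle : ∀ ε > 0, |∫ x in (0 : ℝ)..1, g x ^ 2| ≤ M * ε := by
      intro ε hε
      obtain ⟨p, hp⟩ := exists_polynomial_near_of_continuousOn 0 1 g hg ε hε
      have e : ∫ x in (0 : ℝ)..1, g x ^ 2 = ∫ x in (0 : ℝ)..1, g x * (g x - p.eval x) := by
        have i1 : IntervalIntegrable (fun x => g x ^ 2) MeasureTheory.volume 0 1 := by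
          apply ContinuousOn.intervalIntegrable
          rw [hu]; exact hg.pow 2
        have i2 : IntervalIntegrable (fun x => g x * p.eval x) MeasureTheory.volume 0 1 := by
          apply ContinuousOn.intervalIntegrable
          rw [hu]; exact hg.mul p.continuous.continuousOn
        have h1 := intervalIntegral.integral_sub i1 i2
        rw [hpoly p, sub_zero] at h1
        rw [← h1]
        exact intervalIntegral.integral_congr fun x _ => by ring
      rw [e]
      have := intervalIntegral.norm_integral_le_of_norm_le_const (a := (0 : ℝ)) (b := 1)
        (C := M * ε) (f := fun x => g x * (g x - p.eval x)) ?_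
      · simpa using this
      · intro x hx
        rw [Set.uIoc_of_le zero_le_one] at hx
        have hx' : x ∈ Set.Icc (0 : ℝ) 1 := ⟨hx.1.le, hx.2⟩
        rw [norm_mul]
        apply mul_le_mul (hM x hx') _ (norm_nonneg _) hM0
        rw [Real.norm_eq_abs, abs_sub_comm]
        exact (hp x hx').le
    rw [← abs_nonpos_iff]
    apply le_of_forall_pos_le_add
    intro ε hε
    have := hle (ε / (M + 1)) (by positivity)
    refine this.trans ?_
    rw [zero_add, mul_div_assoc', div_le_iff₀ (by positivity)]
    nlinarith
  intro x hx
  by_contra hne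
  have := intervalIntegral.integral_pos (f := fun x => g x ^ 2) zero_lt_one (hg.pow 2)
    (fun x _ => sq_nonneg _) ⟨x, hx, by positivity⟩
  linarith

/-! ### The multiple `t`-harmonic sums of `(1, ..., 1)` -/

theorem tSum_onesComp_zero (n : ℕ) : tSum n (onesComp 0) = 1 := by simp [onesComp, tSum]

theorem tStarSum_onesComp_zero (n : ℕ) : tStarSum n (onesComp 0) = 1 := by
  simp [onesComp, tStarSum]

theorem tSum_onesComp_succ (n k : ℕ) : tSum n (onesComp (k + 1)) =
    ∑ j ∈ Finset.Icc 1 n, 1 / (2 * (j : ℝ) - 1) * tSum (j - 1) (onesComp k) := by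
  simp [onesComp, List.replicate_succ, tSum]

theorem tStarSum_onesComp_succ (n k : ℕ) : tStarSum n (onesComp (k + 1)) =
    ∑ j ∈ Finset.Icc 1 n, 1 / (2 * (j : ℝ) - 1) * tStarSum j (onesComp k) := by
  simp [onesComp, List.replicate_succ, tStarSum]

theorem tSum_succ_onesComp_succ (n k : ℕ) : tSum (n + 1) (onesComp (k + 1)) =
    tSum n (onesComp (k + 1)) + 1 / (2 * (n : ℝ) + 1) * tSum n (onesComp k) := by
  rw [tSum_onesComp_succ, tSum_onesComp_succ, Finset.sum_Icc_succ_top (by omega)]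
  rw [Nat.add_sub_cancel]
  push_cast
  ring_nf

theorem tStarSum_succ_onesComp_succ (n k : ℕ) : tStarSum (n + 1) (onesComp (k + 1)) =
    tStarSum n (onesComp (k + 1)) + 1 / (2 * (n : ℝ) + 1) * tStarSum (n + 1) (onesComp k) := by
  rw [tStarSum_onesComp_succ, tStarSum_onesComp_succ, Finset.sum_Icc_succ_top (by omega)]
  push_cast
  ring_nf

theorem one_div_two_mul_sub_one_nonneg {n j : ℕ} (hj : j ∈ Finset.Icc 1 n) :
    0 ≤ 1 / (2 * (j : ℝ) - 1) := by
  have : (1 : ℝ) ≤ j := by exact_mod_cast (Finset.mem_Icc.mp hj).1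
  apply div_nonneg zero_le_one
  linarith

theorem sum_one_div_two_mul_sub_one_le (n : ℕ) :
    ∑ j ∈ Finset.Icc 1 n, 1 / (2 * (j : ℝ) - 1) ≤ 1 + Real.log n := by
  refine le_trans ?_ (harmonic_le_one_add_log n)
  rw [harmonic_eq_sum_Icc]
  push_cast
  refine Finset.sum_le_sum fun j hj => ?_
  have : (1 : ℝ) ≤ j := by exact_mod_cast (Finset.mem_Icc.mp hj).1
  rw [one_div]
  exact inv_anti₀ (by linarith) (by linarith)

theorem one_add_log_mono {j n : ℕ} (h : j ≤ n) : 1 + Real.log j ≤ 1 + Real.log n := by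
  rcases Nat.eq_zero_or_pos j with rfl | hj
  · simpa using Real.log_natCast_nonneg n
  · have : Real.log j ≤ Real.log n := Real.log_le_log (by exact_mod_cast hj) (by exact_mod_cast h)
    linarith

theorem tSum_onesComp_nonneg (n k : ℕ) : 0 ≤ tSum n (onesComp k) := by
  induction k generalizing n with
  | zero => simp [tSum_onesComp_zero]
  | succ k ih =>
    rw [tSum_onesComp_succ]
    exact Finset.sum_nonneg fun j hj => mul_nonneg (one_div_two_mul_sub_one_nonneg hj) (ih _)

theorem tStarSum_onesComp_nonneg (n k : ℕ) : 0 ≤ tStarSum n (onesComp k) := by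
  induction k generalizing n with
  | zero => simp [tStarSum_onesComp_zero]
  | succ k ih =>
    rw [tStarSum_onesComp_succ]
    exact Finset.sum_nonneg fun j hj => mul_nonneg (one_div_two_mul_sub_one_nonneg hj) (ih _)

theorem tSum_onesComp_le (n k : ℕ) : tSum n (onesComp k) ≤ (1 + Real.log n) ^ k := by
  induction k generalizing n with
  | zero => simp [tSum_onesComp_zero]
  | succ k ih =>
    rw [tSum_onesComp_succ, pow_succ']
    have hn : 0 ≤ 1 + Real.log n := by linarith [Real.log_natCast_nonneg n]
    refine le_trans (Finset.sum_le_sum fun j hj => mul_le_mul_of_nonneg_left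
      ((ih (j - 1)).trans (pow_le_pow_left₀ ?_ (one_add_log_mono (n := n) ?_) k))
      (one_div_two_mul_sub_one_nonneg hj)) ?_
    · linarith [Real.log_natCast_nonneg (j - 1)]
    · have := (Finset.mem_Icc.mp hj).2
      omega
    · rw [← Finset.sum_mul]
      exact mul_le_mul_of_nonneg_right (sum_one_div_two_mul_sub_one_le n) (by positivity)

theorem tStarSum_onesComp_le (n k : ℕ) : tStarSum n (onesComp k) ≤ (1 + Real.log n) ^ k := by
  induction k generalizing n with
  | zero => simp [tStarSum_onesComp_zero]
  | succ k ih =>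
    rw [tStarSum_onesComp_succ, pow_succ']
    have hn : 0 ≤ 1 + Real.log n := by linarith [Real.log_natCast_nonneg n]
    refine le_trans (Finset.sum_le_sum fun j hj => mul_le_mul_of_nonneg_left
      ((ih j).trans (pow_le_pow_left₀ ?_ (one_add_log_mono (n := n) (Finset.mem_Icc.mp hj).2) k))
      (one_div_two_mul_sub_one_nonneg hj)) ?_
    · linarith [Real.log_natCast_nonneg j]
    · rw [← Finset.sum_mul]
      exact mul_le_mul_of_nonneg_right (sum_one_div_two_mul_sub_one_le n) (by positivity)

/-- Powers of the logarithm are `O(n ^ (1/8))`; the exponent has to stay below the decay rate `1/4`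
used for the Legendre polynomials. -/
theorem exists_one_add_log_pow_le (m : ℕ) : ∃ C : ℝ, 0 ≤ C ∧ ∀ n : ℕ,
    (1 + Real.log ((n + 2 : ℕ) : ℝ)) ^ m ≤ C * ((n : ℝ) + 1) ^ (1 / 8 : ℝ) := by
  set ε : ℝ := 1 / (8 * (m + 1)) with hε
  have hε0 : 0 < ε := by positivity
  refine ⟨(1 + 1 / ε) ^ m * 2 ^ (1 / 8 : ℝ), by positivity, fun n => ?_⟩
  have hn : (1 : ℝ) ≤ ((n + 2 : ℕ) : ℝ) := by push_cast; linarith [(Nat.cast_nonneg n : (0 : ℝ) ≤ n)]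
  have h1 : 1 + Real.log ((n + 2 : ℕ) : ℝ) ≤ (1 + 1 / ε) * ((n + 2 : ℕ) : ℝ) ^ ε := by
    have h2 := Real.log_le_rpow_div (by linarith : (0 : ℝ) ≤ ((n + 2 : ℕ) : ℝ)) hε0
    have h3 := Real.one_le_rpow hn hε0.le
    rw [add_mul, one_mul, one_div_mul_eq_div]
    linarith
  have h0 : 0 ≤ 1 + Real.log ((n + 2 : ℕ) : ℝ) := by linarith [Real.log_natCast_nonneg (n + 2)]
  refine (pow_le_pow_left₀ h0 h1 m).trans ?_
  rw [mul_pow, mul_assoc]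
  refine mul_le_mul_of_nonneg_left ?_ (by positivity)
  rw [← Real.mul_rpow (by norm_num) (by positivity), ← Real.rpow_natCast, ← Real.rpow_mul (by linarith)]
  have he : ε * m ≤ 1 / 8 := by
    rw [hε, div_mul_eq_mul_div, div_le_div_iff₀ (by positivity) (by norm_num)]
    linarith
  refine (Real.rpow_le_rpow_of_exponent_le hn he).trans ?_
  refine Real.rpow_le_rpow (by linarith) ?_ (by norm_num)
  push_cast
  linarith [(Nat.cast_nonneg n : (0 : ℝ) ≤ n)]

/-- The coefficient `t_n(1_k) t*_{n+1}(1_l)` of the expansion. -/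
noncomputable def tCoeff (k l n : ℕ) : ℝ := tSum n (onesComp k) * tStarSum (n + 1) (onesComp l)

/-- The sum of the coefficients `t_n(1_k) t*_{n+1}(1_l)` over `k + l = m`. -/
noncomputable def tCoeffTotal (m n : ℕ) : ℝ := ∑ k ∈ Finset.range (m + 1), tCoeff k (m - k) n

theorem tCoeff_nonneg (k l n : ℕ) : 0 ≤ tCoeff k l n :=
  mul_nonneg (tSum_onesComp_nonneg _ _) (tStarSum_onesComp_nonneg _ _)

theorem tSum_succ_sub_le (n k : ℕ) : 0 ≤ tSum (n + 1) (onesComp k) - tSum n (onesComp k) ∧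
    tSum (n + 1) (onesComp k) - tSum n (onesComp k) ≤
      (1 + Real.log ((n + 2 : ℕ) : ℝ)) ^ k / (n + 1) := by
  have hL : 1 ≤ 1 + Real.log ((n + 2 : ℕ) : ℝ) := by linarith [Real.log_natCast_nonneg (n + 2)]
  rcases k with _ | k
  · simp [tSum_onesComp_zero]; positivity
  · rw [tSum_succ_onesComp_succ, add_sub_cancel_left]
    have h0 := tSum_onesComp_nonneg n k
    refine ⟨by positivity, ?_⟩
    rw [← one_div_mul_eq_div ((n : ℝ) + 1)]
    refine mul_le_mul ?_ ?_ h0 (by positivity)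
    · exact one_div_le_one_div_of_le (by positivity) (by linarith [(Nat.cast_nonneg n : (0 : ℝ) ≤ n)])
    · refine (tSum_onesComp_le n k).trans ((pow_le_pow_left₀ ?_
        (one_add_log_mono (n := n + 2) (by omega)) k).trans (pow_le_pow_right₀ hL (by omega)))
      linarith [Real.log_natCast_nonneg n]

theorem tStarSum_succ_sub_le (n k : ℕ) :
    0 ≤ tStarSum (n + 2) (onesComp k) - tStarSum (n + 1) (onesComp k) ∧
    tStarSum (n + 2) (onesComp k) - tStarSum (n + 1) (onesComp k) ≤
      (1 + Real.log ((n + 2 : ℕ) : ℝ)) ^ k / (n + 1) := by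
  have hL : 1 ≤ 1 + Real.log ((n + 2 : ℕ) : ℝ) := by linarith [Real.log_natCast_nonneg (n + 2)]
  rcases k with _ | k
  · simp [tStarSum_onesComp_zero]; positivity
  · rw [tStarSum_succ_onesComp_succ, add_sub_cancel_left]
    have h0 := tStarSum_onesComp_nonneg (n + 2) k
    refine ⟨by positivity, ?_⟩
    rw [← one_div_mul_eq_div ((n : ℝ) + 1)]
    refine mul_le_mul ?_ ?_ h0 (by positivity)
    · refine one_div_le_one_div_of_le (by positivity) ?_
      push_cast
      linarith [(Nat.cast_nonneg n : (0 : ℝ) ≤ n)]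
    · exact (tStarSum_onesComp_le (n + 2) k).trans (pow_le_pow_right₀ hL (by omega))

theorem tCoeff_le (k l : ℕ) : ∃ C : ℝ, 0 ≤ C ∧ ∀ n : ℕ,
    tCoeff k l n ≤ C * ((n : ℝ) + 1) ^ (1 / 8 : ℝ) ∧
    |tCoeff k l (n + 1) - tCoeff k l n| ≤ C * ((n : ℝ) + 1) ^ (1 / 8 : ℝ) / (n + 1) := by
  obtain ⟨C, hC, h⟩ := exists_one_add_log_pow_le (k + l)
  refine ⟨2 * C, by positivity, fun n => ?_⟩
  set Λ := 1 + Real.log ((n + 2 : ℕ) : ℝ) with hΛ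
  have hL : 1 ≤ Λ := by linarith [Real.log_natCast_nonneg (n + 2)]
  have hn := h n
  rw [pow_add] at hn
  have hlog : ∀ j ≤ n + 2, ∀ i, (1 + Real.log (j : ℝ)) ^ i ≤ Λ ^ i := fun j hj i =>
    pow_le_pow_left₀ (by linarith [Real.log_natCast_nonneg j]) (one_add_log_mono hj) i
  have t1 := (tSum_onesComp_le n k).trans (hlog n (by omega) k)
  have t2 := (tStarSum_onesComp_le (n + 1) l).trans (hlog (n + 1) (by omega) l)
  have t3 := (tStarSum_onesComp_le (n + 2) l).trans (hlog (n + 2) (by omega) l)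
  have p1 := tSum_onesComp_nonneg n k
  have p2 := tStarSum_onesComp_nonneg (n + 1) l
  have p3 := tStarSum_onesComp_nonneg (n + 2) l
  obtain ⟨d0, d1⟩ := tSum_succ_sub_le n k
  obtain ⟨e0, e1⟩ := tStarSum_succ_sub_le n l
  unfold tCoeff
  constructor
  · have := mul_le_mul t1 t2 p2 (by positivity)
    have h0 : 0 ≤ C * ((n : ℝ) + 1) ^ (1 / 8 : ℝ) := by positivity
    linarith
  · have e : tSum (n + 1) (onesComp k) * tStarSum (n + 1 + 1) (onesComp l) -
        tSum n (onesComp k) * tStarSum (n + 1) (onesComp l) =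
        (tSum (n + 1) (onesComp k) - tSum n (onesComp k)) * tStarSum (n + 2) (onesComp l) +
        tSum n (onesComp k) * (tStarSum (n + 2) (onesComp l) - tStarSum (n + 1) (onesComp l)) := by
      ring
    rw [e, abs_of_nonneg (by positivity)]
    have q1 := mul_le_mul d1 t3 p3 (by positivity)
    have q2 := mul_le_mul t1 e1 e0 (by positivity)
    have q3 : Λ ^ k / ((n : ℝ) + 1) * Λ ^ l + Λ ^ k * (Λ ^ l / (n + 1)) =
        2 * (Λ ^ k * Λ ^ l) / (n + 1) := by ring
    have q4 : 2 * (Λ ^ k * Λ ^ l) / ((n : ℝ) + 1) ≤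
        2 * C * ((n : ℝ) + 1) ^ (1 / 8 : ℝ) / (n + 1) := by
      apply div_le_div_of_nonneg_right _ (by positivity)
      linarith
    linarith

theorem abs_div_sub_div_le {a : ℕ → ℝ} (n : ℕ) {B : ℝ} (h0 : |a n| ≤ B)
    (h1 : |a (n + 1) - a n| ≤ B / (n + 1)) :
    |a n / (2 * n + 1) - a (n + 1) / (2 * ((n + 1 : ℕ) : ℝ) + 1)| ≤ 3 * (B / (n + 1) ^ 2) := by
  have hB : 0 ≤ B := (abs_nonneg _).trans h0
  have e : a n / (2 * n + 1) - a (n + 1) / (2 * ((n + 1 : ℕ) : ℝ) + 1) =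
      2 * a n / ((2 * n + 1) * (2 * n + 3)) - (a (n + 1) - a n) / (2 * n + 3) := by
    push_cast
    field_simp
    ring
  rw [e]
  refine (abs_sub _ _).trans ?_
  rw [abs_div, abs_div, abs_mul, abs_of_pos (by positivity : (0 : ℝ) < (2 * n + 1) * (2 * n + 3)),
    abs_of_pos (by positivity : (0 : ℝ) < 2 * n + 3), abs_two]
  have q1 : 2 * |a n| / ((2 * (n : ℝ) + 1) * (2 * n + 3)) ≤ 2 * (B / (n + 1) ^ 2) := by
    rw [← mul_div_assoc]
    apply div_le_div₀ (by positivity) (by linarith) (by positivity)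
    nlinarith [(Nat.cast_nonneg n : (0 : ℝ) ≤ n)]
  have q2 : |a (n + 1) - a n| / (2 * (n : ℝ) + 3) ≤ B / (n + 1) ^ 2 := by
    rw [pow_two, ← div_div]
    apply div_le_div₀ (by positivity) h1 (by positivity)
    linarith [(Nat.cast_nonneg n : (0 : ℝ) ≤ n)]
  linarith

/-- Slow variation of `a_n = t_n(1_k) t*_{n+1}(1_l)`: both `a_n = O(n ^ (1/8))` and
`a_n / (2 n + 1) - a_{n+1} / (2 n + 3) = O(n ^ (-15/8))`. -/
theorem tCoeff_div_bounds (k l : ℕ) : ∃ C : ℝ, 0 ≤ C ∧ ∀ n : ℕ,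
    |tCoeff k l n| ≤ C * ((n : ℝ) + 1) ^ (1 / 8 : ℝ) ∧
    |tCoeff k l n / (2 * n + 1) - tCoeff k l (n + 1) / (2 * ((n + 1 : ℕ) : ℝ) + 1)| ≤
      C * ((n : ℝ) + 1) ^ (-(15 / 8) : ℝ) := by
  obtain ⟨C, hC, h⟩ := tCoeff_le k l
  refine ⟨3 * C, by positivity, fun n => ?_⟩
  obtain ⟨h1, h2⟩ := h n
  rw [← abs_of_nonneg (tCoeff_nonneg k l n)] at h1
  have h3 := abs_div_sub_div_le n h1 h2
  have e : ((n : ℝ) + 1) ^ (-(15 / 8) : ℝ) = ((n : ℝ) + 1) ^ (1 / 8 : ℝ) / (n + 1) ^ 2 := by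
    rw [← Real.rpow_sub_natCast (by positivity)]; norm_num
  constructor
  · have : 0 ≤ C * ((n : ℝ) + 1) ^ (1 / 8 : ℝ) := by positivity
    linarith
  · rw [e]
    refine h3.trans (le_of_eq (by ring))

theorem tCoeffTotal_div_bounds (m : ℕ) : ∃ C : ℝ, 0 ≤ C ∧ ∀ n : ℕ,
    |tCoeffTotal m n| ≤ C * ((n : ℝ) + 1) ^ (1 / 8 : ℝ) ∧
    |tCoeffTotal m n / (2 * n + 1) - tCoeffTotal m (n + 1) / (2 * ((n + 1 : ℕ) : ℝ) + 1)| ≤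
      C * ((n : ℝ) + 1) ^ (-(15 / 8) : ℝ) := by
  choose C hC h using fun k => tCoeff_div_bounds k (m - k)
  refine ⟨∑ k ∈ Finset.range (m + 1), C k, Finset.sum_nonneg fun k _ => hC k, fun n => ?_⟩
  unfold tCoeffTotal
  rw [Finset.sum_div, Finset.sum_div, ← Finset.sum_sub_distrib, Finset.sum_mul, Finset.sum_mul]
  exact ⟨(Finset.abs_sum_le_sum_abs _ _).trans (Finset.sum_le_sum fun k _ => (h k n).1),
    (Finset.abs_sum_le_sum_abs _ _).trans (Finset.sum_le_sum fun k _ => (h k n).2)⟩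

theorem tCoeffTotal_zero_left (n : ℕ) : tCoeffTotal 0 n = 1 := by
  simp [tCoeffTotal, tCoeff, tSum_onesComp_zero, tStarSum_onesComp_zero]

theorem tSum_zero_onesComp_succ (k : ℕ) : tSum 0 (onesComp (k + 1)) = 0 := by
  simp [tSum_onesComp_succ]

theorem tStarSum_one_onesComp (k : ℕ) : tStarSum 1 (onesComp k) = 1 := by
  induction k with
  | zero => exact tStarSum_onesComp_zero 1
  | succ k ih => norm_num [tStarSum_onesComp_succ, ih]

theorem tCoeffTotal_zero_right (m : ℕ) : tCoeffTotal m 0 = 1 := by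
  unfold tCoeffTotal
  rw [Finset.sum_range_succ']
  simp [tCoeff, tSum_zero_onesComp_succ, tStarSum_one_onesComp, tSum_onesComp_zero]

open PowerSeries in
/-- The generating series `A_n = ∑ₘ tCoeffTotal m n X ^ m` is
`∏_{j ≤ n} (1 + X / (2 j - 1)) / ∏_{j ≤ n + 1} (1 - X / (2 j - 1))`; the recursion compares
coefficients in `(1 - X / (2 n + 3)) A_{n+1} = (1 + X / (2 n + 1)) A_n`. -/
theorem tCoeffTotal_succ_sub (m n : ℕ) :
    tCoeffTotal (m + 1) (n + 1) - tCoeffTotal (m + 1) n =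
      tCoeffTotal m (n + 1) / (2 * ((n + 1 : ℕ) : ℝ) + 1) + tCoeffTotal m n / (2 * n + 1) := by
  let T : ℕ → ℝ⟦X⟧ := fun n => PowerSeries.mk fun k => tSum n (onesComp k)
  let S : ℕ → ℝ⟦X⟧ := fun n => PowerSeries.mk fun k => tStarSum n (onesComp k)
  have hT : T (n + 1) = (1 + C (1 / (2 * (n : ℝ) + 1)) * X) * T n := by
    ext k
    rw [add_mul, one_mul, mul_assoc, map_add, coeff_C_mul]
    rcases k with _ | k
    · simp [T, tSum_onesComp_zero]
    · rw [coeff_succ_X_mul]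
      simp only [T, coeff_mk]
      rw [tSum_succ_onesComp_succ]
  have hS : S (n + 1) = (1 - C (1 / (2 * ((n + 1 : ℕ) : ℝ) + 1)) * X) * S (n + 2) := by
    ext k
    rw [sub_mul, one_mul, mul_assoc, map_sub, coeff_C_mul]
    rcases k with _ | k
    · simp [S, tStarSum_onesComp_zero]
    · rw [coeff_succ_X_mul]
      simp only [S, coeff_mk]
      rw [tStarSum_succ_onesComp_succ (n + 1) k]
      ring
  have hA : ∀ m n, coeff m (T n * S (n + 1)) = tCoeffTotal m n := by
    intro m n
    rw [coeff_mul, Finset.Nat.sum_antidiagonal_eq_sum_range_succ_mk]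
    simp [T, S, tCoeffTotal, tCoeff]
  have key : (1 - C (1 / (2 * ((n + 1 : ℕ) : ℝ) + 1)) * X) * (T (n + 1) * S (n + 1 + 1)) =
      (1 + C (1 / (2 * (n : ℝ) + 1)) * X) * (T n * S (n + 1)) := by
    rw [hT, hS]; ring
  have := congrArg (coeff (m + 1)) key
  rw [sub_mul, add_mul, one_mul, one_mul, mul_assoc, mul_assoc, map_sub, map_add, coeff_C_mul,
    coeff_C_mul, coeff_succ_X_mul, coeff_succ_X_mul, hA, hA, hA, hA] at this
  linear_combination this

/-- The total coefficient divided by `2 n + 1`; up to the constant `(-1) ^ (m + n) m! 2 ^ (m + 1)`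
this is `∫₀¹ P_n(2 x - 1) log ^ m x / √x dx`. -/
noncomputable def tMoment (m n : ℕ) : ℝ := tCoeffTotal m n / (2 * n + 1)

theorem tCoeffTotal_eq (m n : ℕ) : tCoeffTotal m n = (2 * n + 1) * tMoment m n := by
  unfold tMoment; field_simp

/-- The coefficient which `2 x * (log ^ m x / √x)` has, up to the same sign and constant, where `log ^ m x / √x` has
`(2 n + 1) * tMoment m n`. -/
noncomputable def tMomentDiff (m n : ℕ) : ℝ :=
  (2 * n + 1) * tMoment m n - (n + 1) * tMoment m (n + 1) - n * tMoment m (n - 1)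

theorem tMoment_rec (m n : ℕ) :
    (2 * (n : ℝ) + 3) * tMoment (m + 1) (n + 1) - (2 * n + 1) * tMoment (m + 1) n =
      tMoment m (n + 1) + tMoment m n := by
  have h := tCoeffTotal_succ_sub m n
  rw [tCoeffTotal_eq (m + 1) (n + 1), tCoeffTotal_eq (m + 1) n] at h
  change _ = tMoment m (n + 1) + tMoment m n at h
  push_cast at h
  linear_combination h

/-- A second-order difference that, thanks to the recursion, is a first-order difference. -/
theorem two_mul_tMomentDiff_succ (m n : ℕ) : 2 * tMomentDiff (m + 1) (n + 1) =
    tMoment (m + 1) (n + 2) - tMoment (m + 1) n - (tMoment m (n + 2) - tMoment m n) := by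
  have h1 := tMoment_rec m n
  have h2 := tMoment_rec m (n + 1)
  unfold tMomentDiff
  rw [Nat.add_sub_cancel]
  push_cast at *
  linear_combination h1 - h2

theorem two_mul_tMomentDiff_zero (n : ℕ) : 2 * tMomentDiff 0 (n + 1) =
    tMoment 0 (n + 2) - tMoment 0 n := by
  unfold tMomentDiff tMoment
  simp only [tCoeffTotal_zero_left, Nat.add_sub_cancel]
  push_cast
  field_simp
  ring

theorem summable_add_one_rpow {p : ℝ} (hp : p < -1) : Summable fun n : ℕ => ((n : ℝ) + 1) ^ p := by
  have := (summable_nat_add_iff 1).mpr (Real.summable_nat_rpow.mpr hp)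
  simpa using this

theorem summable_tMoment_sub (m : ℕ) :
    Summable fun n : ℕ => |tMoment m (n + 1) - tMoment m n| := by
  obtain ⟨C, -, h⟩ := tCoeffTotal_div_bounds m
  refine Summable.of_nonneg_of_le (fun _ => abs_nonneg _) (fun n => ?_)
    ((summable_add_one_rpow (p := -(15 / 8)) (by norm_num)).mul_left C)
  rw [abs_sub_comm]
  exact (h n).2

theorem summable_tMoment_sub_two (m : ℕ) :
    Summable fun n : ℕ => |tMoment m (n + 2) - tMoment m n| := by
  have h := summable_tMoment_sub m
  have h1 := (summable_nat_add_iff 1).mpr h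
  refine Summable.of_nonneg_of_le (fun _ => abs_nonneg _) (fun n => ?_) (h.add h1)
  have := abs_add_le (tMoment m (n + 1) - tMoment m n) (tMoment m (n + 2) - tMoment m (n + 1))
  rw [show tMoment m (n + 1) - tMoment m n + (tMoment m (n + 2) - tMoment m (n + 1)) =
    tMoment m (n + 2) - tMoment m n by ring] at this
  exact this

theorem summable_abs_tMomentDiff (m : ℕ) : Summable fun n : ℕ => |tMomentDiff m n| := by
  rw [← summable_nat_add_iff 1]
  rcases m with _ | m
  · refine Summable.of_nonneg_of_le (fun _ => abs_nonneg _) (fun n => ?_)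
      (summable_tMoment_sub_two 0)
    rw [← two_mul_tMomentDiff_zero, abs_mul, abs_two]
    linarith [abs_nonneg (tMomentDiff 0 (n + 1))]
  · refine Summable.of_nonneg_of_le (fun _ => abs_nonneg _) (fun n => ?_)
      ((summable_tMoment_sub_two (m + 1)).add (summable_tMoment_sub_two m))
    have h1 := abs_sub (tMoment (m + 1) (n + 2) - tMoment (m + 1) n)
      (tMoment m (n + 2) - tMoment m n)
    rw [← two_mul_tMomentDiff_succ, abs_mul, abs_two] at h1
    linarith [abs_nonneg (tMomentDiff (m + 1) (n + 1))]

/-! ### The Legendre moments of `log ^ m x / √x` -/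

/-- The function `log ^ m x / √x`, with value `0` at `x = 0`. -/
noncomputable def logPowDivSqrt (m : ℕ) (x : ℝ) : ℝ := Real.log x ^ m / √x

/-- The exponent `-1/4` is small enough for `log ^ m x / √x` to be integrable at `0` and for
`√x log ^ m x` to be continuous there. -/
theorem abs_log_pow_le (m : ℕ) : ∃ C : ℝ, 0 ≤ C ∧ ∀ x : ℝ, 0 < x → x ≤ 1 →
    |Real.log x ^ m| ≤ C * x ^ (-(1 / 4) : ℝ) := by
  set t : ℝ := 1 / (4 * (m + 1)) with ht
  have ht0 : 0 < t := by positivity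
  refine ⟨(1 / t) ^ m, by positivity, fun x hx hx1 => ?_⟩
  have h := (Real.abs_log_mul_self_rpow_lt x t hx hx1 ht0).le
  rw [abs_mul, abs_of_pos (Real.rpow_pos_of_pos hx t)] at h
  have h1 : |Real.log x| ≤ 1 / t * x ^ (-t) := by
    rw [Real.rpow_neg hx.le, ← div_eq_mul_inv, le_div_iff₀ (Real.rpow_pos_of_pos hx t)]
    exact h
  rw [abs_pow]
  refine (pow_le_pow_left₀ (abs_nonneg _) h1 m).trans ?_
  rw [mul_pow, ← Real.rpow_natCast (x ^ (-t)), ← Real.rpow_mul hx.le]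
  refine mul_le_mul_of_nonneg_left ?_ (by positivity)
  apply Real.rpow_le_rpow_of_exponent_ge hx hx1
  have : t * m ≤ 1 / 4 := by
    rw [ht, div_mul_eq_mul_div, div_le_div_iff₀ (by positivity) (by norm_num)]
    linarith
  linarith

theorem measurable_logPowDivSqrt (m : ℕ) : Measurable (logPowDivSqrt m) := by
  unfold logPowDivSqrt
  fun_prop

theorem intervalIntegrable_logPowDivSqrt (m : ℕ) :
    IntervalIntegrable (logPowDivSqrt m) MeasureTheory.volume 0 1 := by
  obtain ⟨C, hC, h⟩ := abs_log_pow_le m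
  have hr : IntervalIntegrable (fun x : ℝ => C * x ^ (-(3 / 4) : ℝ)) MeasureTheory.volume 0 1 :=
    (intervalIntegral.intervalIntegrable_rpow' (by norm_num)).const_mul C
  refine hr.mono_fun (measurable_logPowDivSqrt m).aestronglyMeasurable ?_
  refine (MeasureTheory.ae_restrict_iff' measurableSet_uIoc).mpr (Eventually.of_forall ?_)
  intro x hx
  rw [Set.uIoc_of_le zero_le_one] at hx
  have hx0 : 0 < x := hx.1
  have h1 := h x hx0 hx.2
  simp only [Real.norm_eq_abs]
  rw [abs_of_nonneg (by positivity : 0 ≤ C * x ^ (-(3 / 4) : ℝ)), logPowDivSqrt, abs_div,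
    abs_of_nonneg (Real.sqrt_nonneg x), div_le_iff₀ (Real.sqrt_pos.mpr hx0), Real.sqrt_eq_rpow,
    mul_assoc, ← Real.rpow_add hx0]
  norm_num at h1 ⊢
  exact h1

theorem mul_logPowDivSqrt (m : ℕ) (x : ℝ) : x * logPowDivSqrt m x = Real.log x ^ m * √x := by
  rw [logPowDivSqrt, mul_div_left_comm, Real.div_sqrt]

theorem continuousOn_mul_logPowDivSqrt (m : ℕ) :
    ContinuousOn (fun x => x * logPowDivSqrt m x) (Set.Icc 0 1) := by
  simp only [mul_logPowDivSqrt]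
  intro x hx
  rcases hx.1.eq_or_lt with rfl | hx0
  · obtain ⟨C, hC, h⟩ := abs_log_pow_le m
    have h0 : Real.log 0 ^ m * √(0 : ℝ) = 0 := by simp
    rw [ContinuousWithinAt, h0]
    have ht : Tendsto (fun x : ℝ => C * x ^ (1 / 4 : ℝ)) (𝓝[Set.Icc 0 1] 0) (𝓝 0) := by
      have : ContinuousAt (fun x : ℝ => C * x ^ (1 / 4 : ℝ)) 0 :=
        (Real.continuousAt_rpow_const 0 (1 / 4) (Or.inr (by norm_num))).const_mul C
      have h2 := this.tendsto.mono_left (nhdsWithin_le_nhds (s := Set.Icc 0 1))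
      simpa using h2
    refine squeeze_zero_norm' ?_ ht
    filter_upwards [self_mem_nhdsWithin] with x hx
    rcases hx.1.eq_or_lt with rfl | hx0
    · simp
    · have h1 := h x hx0 hx.2
      rw [Real.norm_eq_abs, abs_mul, abs_of_nonneg (Real.sqrt_nonneg x)]
      refine (mul_le_mul_of_nonneg_right h1 (Real.sqrt_nonneg x)).trans (le_of_eq ?_)
      rw [Real.sqrt_eq_rpow, mul_assoc, ← Real.rpow_add hx0]
      norm_num
  · exact (((Real.continuousAt_log hx0.ne').pow m).mul
      Real.continuous_sqrt.continuousAt).continuousWithinAt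

/-- The Euler operator maps `log ^ m x / √x` to a combination of itself and of
`log ^ (m - 1) x / √x`; for `m = 0` the second term vanishes. -/
theorem hasDerivAt_mul_logPowDivSqrt (m : ℕ) {x : ℝ} (hx : 0 < x) :
    HasDerivAt (fun x => x * logPowDivSqrt m x)
      (logPowDivSqrt m x / 2 + m * logPowDivSqrt (m - 1) x) x := by
  simp only [mul_logPowDivSqrt]
  convert! ((Real.hasDerivAt_log hx.ne').pow m).mul (Real.hasDerivAt_sqrt hx.ne') using 1
  unfold logPowDivSqrt
  have hinv : x⁻¹ * √x = 1 / √x := by rw [inv_mul_eq_div, Real.sqrt_div_self']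
  simp only [Pi.pow_apply]
  linear_combination -(m * Real.log x ^ (m - 1)) * hinv

/-- The moment `∫₀¹ log ^ m x / √x P_n(2 x - 1) dx`. -/
noncomputable def logMoment (m n : ℕ) : ℝ :=
  ∫ x in (0 : ℝ)..1, logPowDivSqrt m x * (legendreP n).eval (2 * x - 1)

theorem intervalIntegrable_logPowDivSqrt_mul (m n : ℕ) :
    IntervalIntegrable (fun x => logPowDivSqrt m x * (legendreP n).eval (2 * x - 1))
      MeasureTheory.volume 0 1 :=
  (intervalIntegrable_logPowDivSqrt m).mul_continuousOn
    (continuous_eval_legendreP_shift n).continuousOn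

theorem logMoment_zero_rec (m : ℕ) :
    logMoment m 0 / 2 + m * logMoment (m - 1) 0 = if m = 0 then 1 else 0 := by
  have h := intervalIntegral.integral_eq_sub_of_hasDerivAt_of_le zero_le_one
    (continuousOn_mul_logPowDivSqrt m)
    (fun x hx => hasDerivAt_mul_logPowDivSqrt m hx.1)
    (((intervalIntegrable_logPowDivSqrt m).div_const 2).add
      ((intervalIntegrable_logPowDivSqrt (m - 1)).const_mul m))
  rw [intervalIntegral.integral_add ((intervalIntegrable_logPowDivSqrt m).div_const 2)
    ((intervalIntegrable_logPowDivSqrt (m - 1)).const_mul m), intervalIntegral.integral_div,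
    intervalIntegral.integral_const_mul] at h
  simp only [logMoment, legendreP_zero, Polynomial.eval_one, mul_one]
  rw [h]
  by_cases hm : m = 0 <;> simp [logPowDivSqrt, hm]

/-- Integration of the derivative of `x f (P_{n+1} - P_n)`, where `f = log ^ m x / √x`. -/
theorem logMoment_rec (m n : ℕ) :
    ((n : ℝ) + 3 / 2) * logMoment m (n + 1) + (n + 1 / 2) * logMoment m n +
      m * (logMoment (m - 1) (n + 1) - logMoment (m - 1) n) = 0 := by
  have hi := fun m n => intervalIntegrable_logPowDivSqrt_mul m n
  have hd : ∀ x ∈ Set.Ioo (0 : ℝ) 1, HasDerivAt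
      (fun x => (x * logPowDivSqrt m x) *
        ((legendreP (n + 1)).eval (2 * x - 1) - (legendreP n).eval (2 * x - 1)))
      (((n : ℝ) + 3 / 2) * (logPowDivSqrt m x * (legendreP (n + 1)).eval (2 * x - 1)) +
        (n + 1 / 2) * (logPowDivSqrt m x * (legendreP n).eval (2 * x - 1)) +
        m * (logPowDivSqrt (m - 1) x * (legendreP (n + 1)).eval (2 * x - 1) -
          logPowDivSqrt (m - 1) x * (legendreP n).eval (2 * x - 1))) x := by
    intro x hx
    have h1 := (hasDerivAt_mul_logPowDivSqrt m hx.1).mul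
      ((hasDerivAt_eval_legendreP_shift (n + 1) x).sub (hasDerivAt_eval_legendreP_shift n x))
    have h2 := congrArg (Polynomial.eval (2 * x - 1)) (X_add_one_mul_derivative_legendreP_sub n)
    simp at h2
    convert! h1 using 1
    simp only [Pi.sub_apply]
    linear_combination -(logPowDivSqrt m x) * h2
  have hint := (((hi m (n + 1)).const_mul ((n : ℝ) + 3 / 2)).add
    ((hi m n).const_mul ((n : ℝ) + 1 / 2))).add
      (((hi (m - 1) (n + 1)).sub (hi (m - 1) n)).const_mul (m : ℝ))
  have h := intervalIntegral.integral_eq_sub_of_hasDerivAt_of_le zero_le_one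
    ((continuousOn_mul_logPowDivSqrt m).mul ((continuous_eval_legendreP_shift (n + 1)).sub
      (continuous_eval_legendreP_shift n)).continuousOn) hd hint
  rw [intervalIntegral.integral_add (((hi m (n + 1)).const_mul ((n : ℝ) + 3 / 2)).add
    ((hi m n).const_mul ((n : ℝ) + 1 / 2)))
      (((hi (m - 1) (n + 1)).sub (hi (m - 1) n)).const_mul (m : ℝ)),
    intervalIntegral.integral_add ((hi m (n + 1)).const_mul ((n : ℝ) + 3 / 2))
    ((hi m n).const_mul ((n : ℝ) + 1 / 2)), intervalIntegral.integral_const_mul,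
    intervalIntegral.integral_const_mul, intervalIntegral.integral_const_mul,
    intervalIntegral.integral_sub (hi (m - 1) (n + 1)) (hi (m - 1) n)] at h
  unfold logMoment
  rw [h]
  norm_num [eval_one_legendreP]

/-- Both sides satisfy the same recursion, first in `n` for fixed `m`, and in `m` at `n = 0`. -/
theorem logMoment_eq (m n : ℕ) : logMoment m n =
    (-1) ^ m * (m.factorial : ℝ) * 2 ^ (m + 1) * ((-1) ^ n * tMoment m n) := by
  induction m generalizing n with
  | zero =>
    induction n with
    | zero =>
      have h := logMoment_zero_rec 0
      simp at h
      simp [tMoment, tCoeffTotal_zero_left]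
      linarith
    | succ n ih =>
      have h := logMoment_rec 0 n
      rw [ih] at h
      simp only [tMoment, tCoeffTotal_zero_left] at h ⊢
      have h0 : ((n : ℝ) + 3 / 2) ≠ 0 := by positivity
      apply mul_left_cancel₀ h0
      have e1 : ((n : ℝ) + 1 / 2) * (1 / (2 * n + 1)) = 1 / 2 := by field_simp
      have e2 : ((n : ℝ) + 3 / 2) * (1 / (2 * (n + 1) + 1)) = 1 / 2 := by field_simp; ring
      push_cast at h ⊢
      linear_combination h - 2 * (-1) ^ n * e1 + 2 * (-1) ^ n * e2
  | succ m ihm =>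
    induction n with
    | zero =>
      have h := logMoment_zero_rec (m + 1)
      rw [Nat.add_sub_cancel, ihm] at h
      simp [tMoment, tCoeffTotal_zero_right] at h ⊢
      rw [Nat.factorial_succ]
      push_cast
      linear_combination 2 * h
    | succ n ih =>
      have h := logMoment_rec (m + 1) n
      rw [Nat.add_sub_cancel, ihm, ihm, ih] at h
      have h0 : ((n : ℝ) + 3 / 2) ≠ 0 := by positivity
      have h1 := tMoment_rec m n
      apply mul_left_cancel₀ h0
      rw [Nat.factorial_succ] at h ⊢
      push_cast at h ⊢
      linear_combination h - (-1) ^ m * ((m : ℝ) + 1) * (m.factorial : ℝ) * 2 ^ (m + 1) *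
        (-1) ^ n * h1

/-- The Legendre coefficients of `x * (log ^ m x / √x)`. -/
theorem integral_mul_logPowDivSqrt_mul_legendreP (m n : ℕ) :
    (2 * (n : ℝ) + 1) *
      ∫ x in (0 : ℝ)..1, (x * logPowDivSqrt m x) * (legendreP n).eval (2 * x - 1) =
    (-1) ^ m * (m.factorial : ℝ) * 2 ^ m * ((-1) ^ n * tMomentDiff m n) := by
  have h := integral_mul_legendreP_recurrence (intervalIntegrable_logPowDivSqrt m) n
  change _ = _ * logMoment m n + _ * logMoment m (n + 1) + _ * logMoment m (n - 1) at h
  rw [logMoment_eq, logMoment_eq, logMoment_eq] at h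
  unfold tMomentDiff
  rcases n with _ | n
  · simp at h ⊢
    rw [pow_succ] at h
    linear_combination h / 2
  · rw [Nat.add_sub_cancel] at *
    rw [pow_succ _ m] at h
    push_cast at *
    linear_combination h / 2

/-! ### Higher derivatives -/

theorem hasDerivAt_log_pow_div_rpow (j : ℕ) (p : ℝ) {x : ℝ} (hx : 0 < x) :
    HasDerivAt (fun y : ℝ => Real.log y ^ j / y ^ p)
      ((j * Real.log x ^ (j - 1) - p * Real.log x ^ j) / x ^ (p + 1)) x := by
  have hp : x ^ p ≠ 0 := (Real.rpow_pos_of_pos hx p).ne'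
  convert! ((Real.hasDerivAt_log hx.ne').pow j).div
    (Real.hasDerivAt_rpow_const (p := p) (Or.inl hx.ne')) hp using 1
  simp only [Pi.pow_apply]
  rw [Real.rpow_add_one hx.ne', Real.rpow_sub_one hx.ne']
  field_simp

/-- The identity between coefficients behind the induction step for the higher derivatives: the
factor `m - k` brought down from `log ^ (m - k)` turns the `k`-th coefficient into `-1/2` times the
`(k + 1)`-st. -/
theorem tSum_derivative_sum (m n : ℕ) (L : ℝ) :
    ∑ k ∈ Finset.range (m + 1), (-1 : ℝ) ^ k * (k.factorial : ℝ) * (m.choose k : ℝ) * 2 ^ k *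
        tSum n (onesComp k) * (((m - k : ℕ) : ℝ) * L ^ (m - k - 1) - (n + 1 / 2) * L ^ (m - k)) =
      -((n : ℝ) + 1 / 2) * ∑ k ∈ Finset.range (m + 1),
        (-1 : ℝ) ^ k * (k.factorial : ℝ) * (m.choose k : ℝ) * 2 ^ k *
          tSum (n + 1) (onesComp k) * L ^ (m - k) := by
  simp only [mul_sub, Finset.sum_sub_distrib]
  rw [Finset.sum_range_succ]
  rw [Finset.sum_range_succ' (fun k => (-1 : ℝ) ^ k * (k.factorial : ℝ) * (m.choose k : ℝ) * 2 ^ k *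
        tSum n (onesComp k) * (((n : ℝ) + 1 / 2) * L ^ (m - k))),
    Finset.sum_range_succ' (fun k => (-1 : ℝ) ^ k * (k.factorial : ℝ) * (m.choose k : ℝ) * 2 ^ k *
        tSum (n + 1) (onesComp k) * L ^ (m - k))]
  rw [mul_add, Finset.mul_sum, tSum_onesComp_zero, tSum_onesComp_zero]
  have key : ∀ k ∈ Finset.range m,
      (-1 : ℝ) ^ k * (k.factorial : ℝ) * (m.choose k : ℝ) * 2 ^ k *
        tSum n (onesComp k) * (((m - k : ℕ) : ℝ) * L ^ (m - k - 1)) =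
      (-1 : ℝ) ^ (k + 1) * ((k + 1).factorial : ℝ) * (m.choose (k + 1) : ℝ) * 2 ^ (k + 1) *
        tSum n (onesComp (k + 1)) * (((n : ℝ) + 1 / 2) * L ^ (m - (k + 1))) +
      -((n : ℝ) + 1 / 2) * ((-1 : ℝ) ^ (k + 1) * ((k + 1).factorial : ℝ) *
        (m.choose (k + 1) : ℝ) * 2 ^ (k + 1) * tSum (n + 1) (onesComp (k + 1)) *
          L ^ (m - (k + 1))) := by
    intro k hk
    have hc : (m.choose (k + 1) : ℝ) * (k + 1) = m.choose k * ((m - k : ℕ) : ℝ) := by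
      exact_mod_cast Nat.choose_succ_right_eq m k
    rw [tSum_succ_onesComp_succ, Nat.factorial_succ, Nat.sub_sub]
    push_cast
    field_simp
    linear_combination -2 * (-1 : ℝ) ^ k * 2 ^ k * tSum n (onesComp k) *
      L ^ (m - (k + 1)) * hc
  rw [Finset.sum_congr rfl key, Finset.sum_add_distrib]
  simp
  ring

theorem iteratedDeriv_log_pow_div_sqrt (m n : ℕ) {x : ℝ} (hx : 0 < x) :
    iteratedDeriv n (fun y : ℝ => Real.log y ^ m / √y) x =
      (-1 : ℝ) ^ n * (((2 * n).factorial : ℝ) / ((n.factorial : ℝ) * 4 ^ n)) *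
        ∑ k ∈ Finset.range (m + 1),
          (-1 : ℝ) ^ k * (k.factorial : ℝ) * (m.choose k : ℝ) * 2 ^ k *
            tSum n (onesComp k) * (Real.log x ^ (m - k) / x ^ ((n : ℝ) + 1 / 2)) := by
  induction n generalizing x with
  | zero =>
    rw [Finset.sum_range_succ']
    simp [tSum_zero_onesComp_succ, tSum_onesComp_zero, Real.sqrt_eq_rpow]
  | succ n ih =>
    rw [iteratedDeriv_succ]
    have he := eventually_gt_nhds hx |>.mono fun y hy => ih hy
    rw [EventuallyEq.deriv_eq he]
    have hd := (HasDerivAt.fun_sum fun k (_ : k ∈ Finset.range (m + 1)) =>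
      (hasDerivAt_log_pow_div_rpow (m - k) ((n : ℝ) + 1 / 2) hx).const_mul
        ((-1 : ℝ) ^ k * (k.factorial : ℝ) * (m.choose k : ℝ) * 2 ^ k * tSum n (onesComp k)))
      |>.const_mul ((-1 : ℝ) ^ n * (((2 * n).factorial : ℝ) / ((n.factorial : ℝ) * 4 ^ n)))
    rw [hd.deriv]
    simp only [← mul_div_assoc, ← Finset.sum_div]
    rw [tSum_derivative_sum]
    -- The factor `-(n + 1/2)` from the power of `x` is the ratio of the prefactors.
    have hq : ((2 * (n + 1)).factorial : ℝ) / (((n + 1).factorial : ℝ) * 4 ^ (n + 1)) =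
        ((2 * n).factorial : ℝ) / ((n.factorial : ℝ) * 4 ^ n) * (n + 1 / 2) := by
      rw [show 2 * (n + 1) = 2 * n + 1 + 1 by ring, Nat.factorial_succ, Nat.factorial_succ,
        Nat.factorial_succ]
      push_cast
      field_simp
      ring
    rw [mul_div_assoc _ ((2 * (n + 1)).factorial : ℝ), hq]
    rw [show ((n + 1 : ℕ) : ℝ) + 1 / 2 = (n : ℝ) + 1 / 2 + 1 by push_cast; ring]
    ring

/-! ### Absolutely convergent Legendre series -/

/-- A continuous function on `[0, 1]` with absolutely summable Legendre coefficients is the sum of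
its Legendre series. -/
theorem hasSum_legendre_of_summable {g : ℝ → ℝ} (hg : ContinuousOn g (Set.Icc 0 1)) {c : ℕ → ℝ}
    (hc : ∀ n : ℕ, (2 * (n : ℝ) + 1) * ∫ x in (0 : ℝ)..1, g x * (legendreP n).eval (2 * x - 1) = c n)
    (hs : Summable fun n => |c n|) {x : ℝ} (hx : x ∈ Set.Icc (0 : ℝ) 1) :
    HasSum (fun n => c n * (legendreP n).eval (2 * x - 1)) (g x) := by
  have hbound : ∀ n, ∀ x ∈ Set.Icc (0 : ℝ) 1, |(legendreP n).eval (2 * x - 1)| ≤ 1 := fun n x hx =>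
    abs_eval_legendreP_le_one n (abs_le.mpr ⟨by linarith [hx.1], by linarith [hx.2]⟩)
  have hbound' : ∀ n, ∀ x ∈ Set.Icc (0 : ℝ) 1,
      ‖c n * (legendreP n).eval (2 * x - 1)‖ ≤ |c n| := fun n x hx => by
    rw [Real.norm_eq_abs, abs_mul]
    exact mul_le_of_le_one_right (abs_nonneg _) (hbound n x hx)
  have hu : Set.uIcc (0 : ℝ) 1 = Set.Icc 0 1 := Set.uIcc_of_le zero_le_one
  have hcont : ContinuousOn (fun x => ∑' n, c n * (legendreP n).eval (2 * x - 1))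
      (Set.Icc 0 1) :=
    continuousOn_tsum (fun n => ((continuous_eval_legendreP_shift n).const_mul _).continuousOn) hs
      hbound'
  have hint : ∀ j, ∫ x in (0 : ℝ)..1, (∑' n, c n * (legendreP n).eval (2 * x - 1)) *
      (legendreP j).eval (2 * x - 1) =
      ∫ x in (0 : ℝ)..1, g x * (legendreP j).eval (2 * x - 1) := by
    intro j
    let F : ℕ → C(ℝ, ℝ) := fun n =>
      ⟨fun x => c n * (legendreP n).eval (2 * x - 1) * (legendreP j).eval (2 * x - 1),
        ((continuous_eval_legendreP_shift n).const_mul _).mul (continuous_eval_legendreP_shift j)⟩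
    have hF : Summable fun n => ‖(F n).restrict
        (⟨Set.uIcc 0 1, isCompact_uIcc⟩ : TopologicalSpace.Compacts ℝ)‖ := by
      refine Summable.of_nonneg_of_le (fun _ => norm_nonneg _) (fun n => ?_) hs
      refine (ContinuousMap.norm_le _ (abs_nonneg _)).mpr ?_
      rintro ⟨x, hx⟩
      have hx' : x ∈ Set.Icc (0 : ℝ) 1 := by rw [← hu]; exact hx
      change ‖c n * (legendreP n).eval (2 * x - 1) * (legendreP j).eval (2 * x - 1)‖ ≤ _
      rw [norm_mul]
      exact (mul_le_of_le_one_right (norm_nonneg _) (hbound j x hx')).trans (hbound' n x hx')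
    have h1 := intervalIntegral.hasSum_intervalIntegral_of_summable_norm hF
    have h2 : ∀ n, ∫ x in (0 : ℝ)..1, F n x = if n = j then
        ∫ x in (0 : ℝ)..1, g x * (legendreP j).eval (2 * x - 1) else 0 := by
      intro n
      change ∫ x in (0 : ℝ)..1, c n * (legendreP n).eval (2 * x - 1) *
        (legendreP j).eval (2 * x - 1) = _
      simp only [mul_assoc]
      rw [intervalIntegral.integral_const_mul, integral_legendreP_mul_legendreP]
      split_ifs with h
      · subst h
        rw [← hc]
        field_simp
      · rw [mul_zero]
    simp only [h2] at h1
    have h3 := h1.unique (hasSum_ite_eq j _)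
    rw [← h3]
    refine intervalIntegral.integral_congr fun x _ => ?_
    change (∑' n, c n * (legendreP n).eval (2 * x - 1)) * (legendreP j).eval (2 * x - 1) =
      ∑' n, c n * (legendreP n).eval (2 * x - 1) * (legendreP j).eval (2 * x - 1)
    rw [tsum_mul_right]
  have hzero := eq_zero_of_integral_mul_legendreP_eq_zero (hg.sub hcont) (fun j => by
    have i1 : IntervalIntegrable (fun x => g x * (legendreP j).eval (2 * x - 1))
        MeasureTheory.volume 0 1 := by
      apply ContinuousOn.intervalIntegrable
      rw [hu]
      exact hg.mul (continuous_eval_legendreP_shift j).continuousOn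
    have i2 : IntervalIntegrable (fun x => (∑' n, c n * (legendreP n).eval (2 * x - 1)) *
        (legendreP j).eval (2 * x - 1)) MeasureTheory.volume 0 1 := by
      apply ContinuousOn.intervalIntegrable
      rw [hu]
      exact hcont.mul (continuous_eval_legendreP_shift j).continuousOn
    have h1 := intervalIntegral.integral_sub i1 i2
    rw [hint j, sub_self] at h1
    refine Eq.trans (intervalIntegral.integral_congr fun x _ => ?_) h1
    exact sub_mul _ _ _) x hx
  have hsum : Summable fun n => c n * (legendreP n).eval (2 * x - 1) :=
    Summable.of_norm_bounded hs fun n => hbound' n x hx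
  rw [sub_eq_zero.mp hzero]
  exact hsum.hasSum

/-! ### Conditionally convergent Legendre series -/

theorem tendsto_mul_zero_of_rpow_bounds {u v : ℕ → ℝ} {B C : ℝ}
    (hu : ∀ n, |u n| ≤ B * ((n : ℝ) + 1) ^ (1 / 8 : ℝ))
    (hv : ∀ n, |v n| ≤ C * ((n : ℝ) + 1) ^ (-(1 / 4) : ℝ)) :
    Tendsto (fun n => u n * v n) atTop (𝓝 0) := by
  have h : Tendsto (fun n : ℕ => B * C * ((n : ℝ) + 1) ^ (-(1 / 8) : ℝ)) atTop (𝓝 0) := by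
    have h1 := (tendsto_rpow_neg_atTop (show (0 : ℝ) < 1 / 8 by norm_num)).comp
      (tendsto_natCast_atTop_atTop (R := ℝ) |>.atTop_add (tendsto_const_nhds (x := (1 : ℝ))))
    simpa using h1.const_mul (B * C)
  refine squeeze_zero_norm (fun n => ?_) h
  rw [Real.norm_eq_abs, abs_mul]
  refine (mul_le_mul (hu n) (hv n) (abs_nonneg _) ((abs_nonneg _).trans (hu n))).trans
    (le_of_eq ?_)
  rw [mul_mul_mul_comm, ← Real.rpow_add (by positivity)]
  norm_num

theorem abs_shift_le {a : ℕ → ℝ} {C : ℝ} (hC : 0 ≤ C)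
    (ha : ∀ n, |a n| ≤ C * ((n : ℝ) + 1) ^ (1 / 8 : ℝ)) (n : ℕ) :
    |a (n + 1)| ≤ C * 2 ^ (1 / 8 : ℝ) * ((n : ℝ) + 1) ^ (1 / 8 : ℝ) := by
  refine (ha (n + 1)).trans ?_
  rw [mul_assoc, ← Real.mul_rpow (by norm_num) (by positivity)]
  refine mul_le_mul_of_nonneg_left (Real.rpow_le_rpow (by positivity) ?_ (by norm_num)) hC
  push_cast
  linarith [(Nat.cast_nonneg n : (0 : ℝ) ≤ n)]

theorem abs_add_one_mul_div_le (n : ℕ) (a : ℝ) {q : ℝ} (hq : (n : ℝ) + 1 ≤ q) :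
    |((n : ℝ) + 1) * (a / q)| ≤ |a| := by
  have hn : (0 : ℝ) < n + 1 := by positivity
  rw [abs_mul, abs_div, abs_of_pos hn, abs_of_pos (hn.trans_le hq), mul_div_left_comm]
  exact mul_le_of_le_one_right (abs_nonneg _) ((div_le_one (hn.trans_le hq)).mpr hq)

theorem abs_eval_legendreP_succ_le {z C : ℝ} (hC : 0 ≤ C)
    (hP : ∀ n : ℕ, |(legendreP n).eval z| ≤ C * ((n : ℝ) + 1) ^ (-(1 / 4) : ℝ)) (n : ℕ) :
    |(legendreP (n + 1)).eval z| ≤ C * ((n : ℝ) + 1) ^ (-(1 / 4) : ℝ) := by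
  refine (hP (n + 1)).trans (mul_le_mul_of_nonneg_left ?_ hC)
  apply Real.rpow_le_rpow_of_nonpos (by positivity) _ (by norm_num)
  push_cast
  linarith

/-- Convergence of `∑ aₙ Pₙ(z)` for slowly varying `aₙ` and `|z| < 1`. Since
`(1 - z) (2 n + 1) Pₙ = D_{n+1} - D_n` with `D_n = n (P_{n-1} - P_n)`, summation by parts gives the
absolutely convergent series of the `(a_n / (2 n + 1) - a_{n+1} / (2 n + 3)) D_{n+1}`. -/
theorem exists_tendsto_sum_mul_legendreP {a : ℕ → ℝ} (ha : ∃ C : ℝ, 0 ≤ C ∧ ∀ n : ℕ,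
      |a n| ≤ C * ((n : ℝ) + 1) ^ (1 / 8 : ℝ) ∧
      |a n / (2 * n + 1) - a (n + 1) / (2 * ((n + 1 : ℕ) : ℝ) + 1)| ≤
        C * ((n : ℝ) + 1) ^ (-(15 / 8) : ℝ)) {z : ℝ} (hz : |z| < 1) :
    ∃ S : ℝ, Tendsto (fun N => ∑ n ∈ Finset.range N, a n * (legendreP n).eval z) atTop (𝓝 S) := by
  obtain ⟨C, hC, ha⟩ := ha
  obtain ⟨C', hC', hP⟩ := abs_eval_legendreP_le_rpow hz
  have hP' := abs_eval_legendreP_succ_le hC' hP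
  have hz1 : 1 - z ≠ 0 := by linarith [(abs_lt.mp hz).2]
  set b : ℕ → ℝ := fun n => a n / (2 * n + 1) with hb
  set D : ℕ → ℝ := fun n => n * ((legendreP (n - 1)).eval z - (legendreP n).eval z) with hD
  have hdiff : ∀ n : ℕ,
      |(legendreP n).eval z - (legendreP (n + 1)).eval z| ≤
        2 * C' * ((n : ℝ) + 1) ^ (-(1 / 4) : ℝ) := fun n => by
    have := abs_sub ((legendreP n).eval z) ((legendreP (n + 1)).eval z)
    linarith [hP n, hP' n]
  have hsum : ∀ N, ∑ n ∈ Finset.range N, a n * (legendreP n).eval z =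
      (1 - z)⁻¹ * (b N * D N + ∑ n ∈ Finset.range N, (b n - b (n + 1)) * D (n + 1)) := by
    intro N
    rw [eq_inv_mul_iff_mul_eq₀ hz1]
    induction N with
    | zero => simp [hD]
    | succ N ih =>
      rw [Finset.sum_range_succ, Finset.sum_range_succ, mul_add, ih]
      have hr := eval_legendreP_recurrence N z
      have haN : a N = (2 * N + 1) * b N := by simp only [hb]; field_simp
      rw [haN]
      simp only [hD, Nat.add_sub_cancel]
      push_cast
      linear_combination b N * hr
  have hbdry : Tendsto (fun N => b N * D N) atTop (𝓝 0) := by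
    rw [← tendsto_add_atTop_iff_nat 1]
    have h := tendsto_mul_zero_of_rpow_bounds
      (u := fun n => ((n : ℝ) + 1) * (a (n + 1) / (2 * ((n + 1 : ℕ) : ℝ) + 1)))
      (fun n => (abs_add_one_mul_div_le n (a (n + 1)) (by push_cast; linarith)).trans
        (abs_shift_le hC (fun n => (ha n).1) n)) hdiff
    refine h.congr fun n => ?_
    simp only [hb, hD, Nat.add_sub_cancel]
    push_cast
    ring
  have hsummable : Summable fun n => (b n - b (n + 1)) * D (n + 1) := by
    refine Summable.of_norm_bounded (g := fun n : ℕ => C * (2 * C') * ((n : ℝ) + 1) ^ (-(9 / 8) : ℝ))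
      ((summable_add_one_rpow (by norm_num)).mul_left _) fun n => ?_
    have hn : (0 : ℝ) < n + 1 := by positivity
    have h1 : |D (n + 1)| ≤ ((n : ℝ) + 1) * (2 * C' * ((n : ℝ) + 1) ^ (-(1 / 4) : ℝ)) := by
      simp only [hD, Nat.add_sub_cancel]
      push_cast
      rw [abs_mul, abs_of_pos hn]
      exact mul_le_mul_of_nonneg_left (hdiff n) hn.le
    rw [Real.norm_eq_abs, abs_mul]
    refine (mul_le_mul (ha n).2 h1 (abs_nonneg _) (by positivity)).trans (le_of_eq ?_)
    have e : ((n : ℝ) + 1) ^ (-(9 / 8) : ℝ) = ((n : ℝ) + 1) ^ (-(15 / 8) : ℝ) *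
        ((n + 1) * ((n : ℝ) + 1) ^ (-(1 / 4) : ℝ)) := by
      nth_rw 3 [← Real.rpow_one ((n : ℝ) + 1)]
      rw [← Real.rpow_add hn, ← Real.rpow_add hn]
      norm_num
    rw [e]
    ring
  refine ⟨_, (Tendsto.const_mul (1 - z)⁻¹
    (hbdry.add hsummable.hasSum.tendsto_sum_nat)).congr fun N => (hsum N).symm⟩

/-- Multiplication by `1 - z` acts on the partial sums of the total series, up to a boundary term,
by passing to the coefficients `tMomentDiff`. -/
theorem sum_tCoeffTotal_mul_legendreP (m : ℕ) (z : ℝ) (N : ℕ) :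
    (1 - z) * ∑ n ∈ Finset.range N, tCoeffTotal m n * (legendreP n).eval z =
      ∑ n ∈ Finset.range N, tMomentDiff m n * (legendreP n).eval z +
        N * (tMoment m N * (legendreP (N - 1)).eval z - tMoment m (N - 1) * (legendreP N).eval z) := by
  induction N with
  | zero => simp
  | succ N ih =>
    rw [Finset.sum_range_succ, Finset.sum_range_succ, mul_add, ih, tCoeffTotal_eq]
    have hr := eval_legendreP_recurrence N z
    unfold tMomentDiff
    rw [Nat.add_sub_cancel]
    push_cast
    linear_combination tMoment m N * hr

/-- If the series with coefficients `tMomentDiff` converges to `s`, then `1 - z` times the total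
series converges to `s`: the boundary terms `(n + 1) b_{n+1} P_n` and `(n + 1) b_n P_{n+1}`, with
`b_n = tMoment m n`, tend to `0`. -/
theorem tendsto_sum_tCoeffTotal_mul_legendreP (m : ℕ) {z : ℝ} (hz : |z| < 1) {s : ℝ}
    (hs : HasSum (fun n => tMomentDiff m n * (legendreP n).eval z) s) :
    Tendsto (fun N => (1 - z) * ∑ n ∈ Finset.range N, tCoeffTotal m n * (legendreP n).eval z)
      atTop (𝓝 s) := by
  obtain ⟨C, hC, ha⟩ := tCoeffTotal_div_bounds m
  obtain ⟨C', hC', hP⟩ := abs_eval_legendreP_le_rpow hz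
  have hP' := abs_eval_legendreP_succ_le hC' hP
  have h1 := tendsto_mul_zero_of_rpow_bounds
    (u := fun n => ((n : ℝ) + 1) * (tCoeffTotal m (n + 1) / (2 * ((n + 1 : ℕ) : ℝ) + 1)))
    (fun n => (abs_add_one_mul_div_le n (tCoeffTotal m (n + 1)) (by push_cast; linarith)).trans
      (abs_shift_le hC (fun n => (ha n).1) n)) hP
  have h2 := tendsto_mul_zero_of_rpow_bounds
    (u := fun n => ((n : ℝ) + 1) * (tCoeffTotal m n / (2 * (n : ℝ) + 1)))
    (fun n => (abs_add_one_mul_div_le n (tCoeffTotal m n)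
      (by linarith [(Nat.cast_nonneg n : (0 : ℝ) ≤ n)])).trans (ha n).1) hP'
  have hbdry : Tendsto (fun N : ℕ => (N : ℝ) * (tMoment m N * (legendreP (N - 1)).eval z -
      tMoment m (N - 1) * (legendreP N).eval z)) atTop (𝓝 0) := by
    rw [← tendsto_add_atTop_iff_nat 1]
    have h := h1.sub h2
    rw [sub_zero] at h
    refine h.congr fun n => ?_
    simp only [tMoment, Nat.add_sub_cancel]
    push_cast
    ring
  have h := hs.tendsto_sum_nat.add hbdry
  rw [add_zero] at h
  exact h.congr fun N => (sum_tCoeffTotal_mul_legendreP m z N).symm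

/-! ### The expansion of `log ^ m x / √x` -/

theorem eval_legendreP_one_sub (n : ℕ) (x : ℝ) :
    (legendreP n).eval (1 - 2 * x) = (-1) ^ n * (legendreP n).eval (2 * x - 1) := by
  rw [← eval_neg_legendreP, neg_sub]

/-- The expansion of `log ^ m x / √x`, with the `m + 1` series added up termwise and
`(-1) ^ n P_n(2 x - 1)` written as `P_n(1 - 2 x)`. -/
theorem tendsto_sum_tCoeffTotal_mul_legendreP_shift (m : ℕ) {x : ℝ} (h0 : 0 < x) (h1 : x < 1) :
    Tendsto (fun N => (-1) ^ m * (m.factorial : ℝ) * 2 ^ (m + 1) *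
        ∑ n ∈ Finset.range N, tCoeffTotal m n * (legendreP n).eval (1 - 2 * x))
      atTop (𝓝 (logPowDivSqrt m x)) := by
  set K : ℝ := (-1) ^ m * (m.factorial : ℝ) * 2 ^ m with hK
  have hK0 : K ≠ 0 := by positivity
  have hs := hasSum_legendre_of_summable (continuousOn_mul_logPowDivSqrt m)
    (integral_mul_logPowDivSqrt_mul_legendreP m)
    (((summable_abs_tMomentDiff m).mul_left |K|).congr fun n => by simp [hK, abs_mul])
    ⟨h0.le, h1.le⟩
  have hs' : HasSum (fun n => tMomentDiff m n * (legendreP n).eval (1 - 2 * x))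
      (K⁻¹ * (x * logPowDivSqrt m x)) := by
    convert! hs.mul_left K⁻¹ using 1
    ext n
    rw [eval_legendreP_one_sub, ← hK]
    field_simp
  have hz : |1 - 2 * x| < 1 := abs_lt.mpr ⟨by linarith, by linarith⟩
  have h := (tendsto_sum_tCoeffTotal_mul_legendreP m hz hs').const_mul (K / x)
  convert! h using 1
  · ext N
    rw [hK, pow_succ]
    field_simp
    ring
  · congr 1
    field_simp

theorem mainTheorem8 (m : ℕ) :
    -- pointwise expansion: every inner series converges (in its natural order)
    (∀ x : ℝ, 0 < x → x < 1 →
      ∃ S : ℕ → ℝ,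
        (∀ k ∈ Finset.range (m + 1),
          Tendsto
            (fun N : ℕ => ∑ n ∈ Finset.range N,
              (-1 : ℝ) ^ n * tSum n (onesComp k) * tStarSum (n + 1) (onesComp (m - k)) *
                (legendreP n).eval (2 * x - 1))
            atTop (𝓝 (S k))) ∧
        Real.log x ^ m / √x =
          (-1 : ℝ) ^ m * (m.factorial : ℝ) * 2 ^ (m + 1) * ∑ k ∈ Finset.range (m + 1), S k) ∧
    -- its coefficients are the Fourier-Legendre coefficients
    (∀ n : ℕ,
      IntervalIntegrable
        (fun x : ℝ => (legendreP n).eval (2 * x - 1) * (Real.log x ^ m / √x))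
        MeasureTheory.volume 0 1 ∧
      (2 * (n : ℝ) + 1) *
          ∫ x in (0 : ℝ)..1, (legendreP n).eval (2 * x - 1) * (Real.log x ^ m / √x) =
        (-1 : ℝ) ^ m * (m.factorial : ℝ) * 2 ^ (m + 1) *
          ∑ k ∈ Finset.range (m + 1),
            (-1 : ℝ) ^ n * tSum n (onesComp k) * tStarSum (n + 1) (onesComp (m - k))) ∧
    -- the higher derivatives
    (∀ (n : ℕ) (x : ℝ), 0 < x →
      ContDiffAt ℝ n (fun y : ℝ => Real.log y ^ m / √y) x ∧
      iteratedDeriv n (fun y : ℝ => Real.log y ^ m / √y) x =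
        (-1 : ℝ) ^ n * (((2 * n).factorial : ℝ) / ((n.factorial : ℝ) * 4 ^ n)) *
          ∑ k ∈ Finset.range (m + 1),
            (-1 : ℝ) ^ k * (k.factorial : ℝ) * (m.choose k : ℝ) * 2 ^ k *
              tSum n (onesComp k) * (Real.log x ^ (m - k) / x ^ ((n : ℝ) + 1 / 2))) := by
  refine ⟨fun x h0 h1 => ?_, fun n => ⟨?_, ?_⟩, fun n x hx => ⟨?_, ?_⟩⟩
  · have hz : |1 - 2 * x| < 1 := abs_lt.mpr ⟨by linarith, by linarith⟩
    choose S hS using fun k => exists_tendsto_sum_mul_legendreP (tCoeff_div_bounds k (m - k)) hz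
    refine ⟨S, fun k _ => (hS k).congr fun N => Finset.sum_congr rfl fun n _ => ?_, ?_⟩
    · rw [eval_legendreP_one_sub, tCoeff]
      ring
    · refine tendsto_nhds_unique (tendsto_sum_tCoeffTotal_mul_legendreP_shift m h0 h1) ?_
      refine ((tendsto_finsetSum _ fun k _ => hS k).const_mul _).congr fun N => ?_
      rw [Finset.sum_comm]
      simp only [tCoeffTotal, Finset.sum_mul]
  · simp only [mul_comm ((legendreP n).eval _)]
    exact intervalIntegrable_logPowDivSqrt_mul m n
  · simp only [mul_comm ((legendreP n).eval _)]
    have h := logMoment_eq m n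
    unfold logMoment logPowDivSqrt at h
    rw [h]
    simp only [mul_assoc ((-1 : ℝ) ^ n), ← Finset.mul_sum]
    change _ = _ * (_ * tCoeffTotal m n)
    rw [tCoeffTotal_eq]
    ring
  · exact ((Real.contDiffAt_log.mpr hx.ne').pow m).div (Real.contDiffAt_sqrt hx.ne')
      (Real.sqrt_pos.mpr hx).ne'
  · exact iteratedDeriv_log_pow_div_sqrt m n hx
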